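/- A \emph{stochastic graph} $G=(U,V,E)$ consists of finite sets $U$ (offline vertices) and $V$ (online vertices), the edge set $E=U\times V$, edge weights $w_e\in\mathbb R$ and edge probabilities $p_e\in[0,1]$ for $e\in E$, and, for each $v\in V$, a probing constraint $\mathcal C_v$: a set of strings of distinct edges incident to $v$ which contains the empty string and is substring-closed (every contiguous substring of a string of $\mathcal C_v$ is in $\mathcal C_v$). Each edge $e$ is active independently with probability $p_e$. An \emph{offline probing algorithm} knows $G$ but not which edges are active. It adaptively, and possibly using its own randomness, probes edges one after the other, in any order; a probe of $e$ reveals whether $e$ is active, and if $e$ is active the algorithm must irrevocably decide, before its next probe, whether to include $e$ in its matching. For each $v\in V$ the sequence of probed edges incident to $v$ must lie in $\mathcal C_v$, and the included edges must form a matching. The algorithm is \emph{non-adaptive} if the sequence of edges that it probes is a randomized function of $G$ (it does not depend on which edges are active). Let $\mathrm{OPT}(G)$ and $\mathrm{OPT}_{\text{n-adap}}(G)$ be the suprema of the expected weight of the matching over all offline probing algorithms and over all non-adaptive ones, respectively. The \emph{adaptivity gap} of the stochastic matching problem with one-sided probing constraints is \[ \inf_G \frac{\mathrm{OPT}_{\text{n-adap}}(G)}{\mathrm{OPT}(G)},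 \] the infimum being over all stochastic graphs $G$ with $\mathrm{OPT}(G)>0$. \textbf{Theorem.} \begin{enumerate} \item The adaptivity gap is at most $1-1/e$. \item For $s,n\in\mathbb N$ and $p\in[0,1]$ let $G(s,n,p)$ be the stochastic graph with $|U|=s$, $|V|=n$, all weights equal to $1$, all edge probabilities equal to $p$, and unit patience (at most one edge incident to each $v\in V$ may be probed). Let $s=s(n)\in\mathbb N$ and $p=p(n)\in[0,1]$ satisfy $p=o(1/\sqrt n)$, $s\to\infty$, $s\le pn$ for all $n\ge 1$, and $s=(1-o(1))\,pn$ as $n\to\infty$. Then \[ \mathrm{OPT}(G(s,n,p))=(1+o(1))\,s \qquad\text{and}\qquad \mathrm{OPT}_{\text{n-adap}}(G(s,n,p))\le(1+o(1))\Bigl(1-\frac1e\Bigr)s . \] \item The adaptivity gap is exactly $1-1/e$. \end{enumerate} -/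

import Mathlib

open Filter Topology Asymptotics

/-- A bipartite stochastic graph with offline vertices `U`, online vertices `V` and edge set
`U × V` (a missing edge is an edge of probability `0`). Edge `e` has weight `w e` and is active,
independently of all other edges, with probability `p e`. The probing constraint of `v` is a
set `C v` of strings of distinct edges incident to `v`, which contains the empty string and is
closed under taking (contiguous) substrings. -/
structure StochasticGraph (U V : Type*) where
  /-- edge weights -/
  w : U × V → ℝ
  /-- edge probabilities -/
  p : U × V → ℝ
  p_nonneg : ∀ e, 0 ≤ p e
  p_le_one : ∀ e, p e ≤ 1
  /-- probing constraints -/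
  C : V → Set (List (U × V))
  nodup_of_mem : ∀ v, ∀ l ∈ C v, l.Nodup
  incident_of_mem : ∀ v, ∀ l ∈ C v, ∀ e ∈ l, e.2 = v
  nil_mem : ∀ v, [] ∈ C v
  substring_closed : ∀ v, ∀ l ∈ C v, ∀ l' : List (U × V), l' <:+: l → l' ∈ C v

/-- A deterministic adaptive probing strategy, as a decision tree. It either stops, or probes the
edge `e`, thereby learning its state, and continues according to the state. The flag `accept` is
the irrevocable decision, taken before any further probe, whether `e` is put into the matching if
it turns out to be active (an inactive edge can never be put into the matching). -/
inductive ProbeTree (E : Type*) where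
  | halt : ProbeTree E
  | probe (e : E) (accept : Bool) (ifInactive ifActive : ProbeTree E) : ProbeTree E

namespace ProbeTree

variable {E : Type*}

/-- The edges probed, in order, when the edge states are `st` (`st e = true`: `e` is active). -/
def probes : ProbeTree E → (E → Bool) → List E
  | halt, _ => []
  | probe e _ t₀ t₁, st => e :: (if st e then t₁.probes st else t₀.probes st)

/-- The edges put into the matching, in order, when the edge states are `st`. -/
def matched : ProbeTree E → (E → Bool) → List E
  | halt, _ => []
  | probe e a t₀ t₁, st =>
      if st e then (if a then e :: t₁.matched st else t₁.matched st) else t₀.matched st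

/-- The strategy is non-adaptive: the edges which it probes, and their order, do not depend on the
edge states. -/
def NonAdaptive (t : ProbeTree E) : Prop :=
  ∀ st st' : E → Bool, t.probes st = t.probes st'

end ProbeTree

namespace StochasticGraph

variable {U V : Type*} [DecidableEq U] [DecidableEq V]

/-- `t` is a deterministic offline probing algorithm for `G`: whatever the edge states are, for
every online vertex `v` the string of probed edges incident to `v` belongs to `C v`, and
the accepted edges form a matching, that is, no two of them share a vertex. -/
def Feasible (G : StochasticGraph U V) (t : ProbeTree (U × V)) : Prop :=
  ∀ st : U × V → Bool,
    (∀ v : V, (t.probes st).filter (fun e => e.2 = v) ∈ G.C v) ∧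
    (t.matched st).Pairwise (fun e f => e.1 ≠ f.1 ∧ e.2 ≠ f.2)

variable [Fintype U] [Fintype V]

/-- The probability of the edge states `st`, for independent edges. -/
def stateProb (G : StochasticGraph U V) (st : U × V → Bool) : ℝ :=
  ∏ e, if st e then G.p e else 1 - G.p e

/-- The expected weight of the matching returned by the deterministic strategy `t` on `G`. -/
def value (G : StochasticGraph U V) (t : ProbeTree (U × V)) : ℝ :=
  ∑ st : U × V → Bool, G.stateProb st * ((t.matched st).map G.w).sum

/-- The expected weight of the matching returned on `G` by a randomized strategy `μ`, that is, a
probability distribution over deterministic strategies, drawn independently of the edge states. -/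
noncomputable def expectedWeight (G : StochasticGraph U V) (μ : PMF (ProbeTree (U × V))) : ℝ :=
  ∑' t, (μ t).toReal * G.value t

/-- `OPT(G)`: the optimum over all (adaptive, randomized) offline probing algorithms. -/
noncomputable def OPT (G : StochasticGraph U V) : ℝ :=
  sSup {x : ℝ | ∃ μ : PMF (ProbeTree (U × V)),
    (∀ t ∈ μ.support, G.Feasible t) ∧ x = G.expectedWeight μ}

/-- The non-adaptive benchmark: the optimum over all offline probing algorithms whose sequence of
probes is a randomized function of `G`, i.e. a function of `G` and of the algorithm's own random
choices only. -/
noncomputable def OPTNonAdaptive (G : StochasticGraph U V) : ℝ :=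
  sSup {x : ℝ | ∃ μ : PMF (ProbeTree (U × V)),
    (∀ t ∈ μ.support, G.Feasible t ∧ t.NonAdaptive) ∧ x = G.expectedWeight μ}

end StochasticGraph

/-- The probing constraint given by patience values `ℓ`: at most `ℓ v` edges incident to `v` may be
probed. -/
def patienceConstraint {U V : Type*} (ℓ : V → ℕ) (v : V) : Set (List (U × V)) :=
  {l | l.Nodup ∧ (∀ e ∈ l, e.2 = v) ∧ l.length ≤ ℓ v}

/-- The unweighted stochastic graph with `s` offline and `n` online vertices, unit patience and all
edge probabilities equal to `p`: its active edges form the bipartite Erdős–Rényi random graph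
`𝔾(s, n, p)`. -/
def erdosRenyiGraph (s n : ℕ) (p : unitInterval) : StochasticGraph (Fin s) (Fin n) where
  w := fun _ => 1
  p := fun _ => p
  p_nonneg := fun _ => p.2.1
  p_le_one := fun _ => p.2.2
  C := patienceConstraint (fun _ => 1)
  nodup_of_mem := fun _ _ hl => hl.1
  incident_of_mem := fun _ _ hl => hl.2.1
  nil_mem := fun _ => ⟨List.nodup_nil, by simp, by simp⟩
  substring_closed := fun _ _ hl _ h =>
    ⟨hl.1.sublist h.sublist, fun e he => hl.2.1 e (h.subset he), h.length_le.trans hl.2.2⟩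

/-- The ratios `OPT_{n-adap}(G) / OPT(G)` over all finite stochastic graphs `G` with
substring-closed probing constraints for which the ratio makes sense. -/
def adaptivityRatios : Set ℝ :=
  {r : ℝ | ∃ (U V : Type) (_ : Fintype U) (_ : Fintype V) (_ : DecidableEq U) (_ : DecidableEq V)
    (G : StochasticGraph U V), 0 < G.OPT ∧ r = G.OPTNonAdaptive / G.OPT}

/-- The adaptivity gap of the stochastic matching problem with one-sided probing constraints. -/
noncomputable def adaptivityGap : ℝ := sInf adaptivityRatios

/-! Lower bound. Let `m (u, v)` be the probability that an adaptive strategy matches `(u, v)`. Seen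
from one `v`, edges at other vertices are only random coins, so `m (·, v)` is a mixture of the
vectors of non-adaptive policies at `v` that propose along their first active marked edge
(`matchProb_mem_convexHull`). Let every `v` act at a uniform time in `Fin N`, and keep a proposal to
`u` at time `k` with probability `(1 - m (u, v) / N) ^ k`. Then `v` has not proposed to `u` through
time `k` with probability `(1 - m (u, v) / N) ^ (k + 1)`, and since `∑ v, m (u, v) ≤ 1`, `u` is
still free with probability at least `(1 - 1 / N) ^ (k + 1)`. Summing over `k` shows that each edge
keeps a share of `m` tending to `1 - 1 / e`. Instead of a random strategy, a multi-affine lower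
bound for the value is maximized over the vertices of the convex hulls, which gives one
deterministic non-adaptive strategy (`Feasible.exists_nonAdaptive_ge`).

Upper bound. In `G(s, n, p)` a non-adaptive strategy fixes the number `c u` of probes at `u`, with
`∑ u, c u ≤ n`, and `u` stays unmatched with probability at least `(1 - p) ^ c u`. By convexity the
best is an even spread `c u = n / s ≈ 1 / p`, leaving a fraction `1 / e` unmatched
(`OPTNonAdaptive_erdosRenyiGraph_le`). An adaptive greedy strategy wastes no probe on a matched
vertex and gets `min(s, Bin(n, p))`, which is `s` up to `O(√(p n))` (`le_OPT_erdosRenyiGraph`). -/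

/-! ### Runs of decision trees -/

namespace ProbeTree

variable {E : Type*}

/-- A run of the tree depends only on the states of the edges which it probes. -/
theorem probes_matched_congr (t : ProbeTree E) {st st' : E → Bool}
    (h : ∀ e ∈ t.probes st, st e = st' e) :
    t.probes st = t.probes st' ∧ t.matched st = t.matched st' := by
  induction t with
  | halt => exact ⟨rfl, rfl⟩
  | probe e a t₀ t₁ ih₀ ih₁ =>
    have he : st e = st' e := h e (by simp [probes])
    by_cases hs : st e = true
    · have := ih₁ (fun x hx => h x (by simp [probes, hs, hx]))
      have hs' := he ▸ hs
      simp [probes, matched, hs, hs', this.1, this.2]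
    · have := ih₀ (fun x hx => h x (by simp [probes, hs, hx]))
      have hs' := he ▸ hs
      simp [probes, matched, hs, hs', this.1, this.2]

theorem matched_sublist_probes (t : ProbeTree E) (st : E → Bool) :
    (t.matched st).Sublist (t.probes st) := by
  induction t with
  | halt => exact List.Sublist.refl _
  | probe e a t₀ t₁ ih₀ ih₁ =>
    by_cases hs : st e = true
    · cases a
      · simpa [probes, matched, hs] using ih₁.cons e
      · simpa [probes, matched, hs] using ih₁
    · simpa [probes, matched, hs] using ih₀.cons e

theorem state_of_mem_matched (t : ProbeTree E) (st : E → Bool) :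
    ∀ e ∈ t.matched st, st e = true := by
  induction t with
  | halt => simp [matched]
  | probe e a t₀ t₁ ih₀ ih₁ =>
    intro f hf
    by_cases hs : st e = true
    · cases a
      · exact ih₁ f (by simpa [matched, hs] using hf)
      · rcases (by simpa [matched, hs] using hf : f = e ∨ f ∈ t₁.matched st) with rfl | h
        · exact hs
        · exact ih₁ f h
    · exact ih₀ f (by simpa [matched, hs] using hf)

/-- No edge is probed twice. -/
def NodupProbes (t : ProbeTree E) : Prop := ∀ st, (t.probes st).Nodup

variable [DecidableEq E]

/-- Passes hypotheses on all states down to a subtree: set the root edge so that the run enters the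
subtree, then undo the change, which the subtree never sees. -/
theorem probes_update_of_notMem {t : ProbeTree E} {e : E} {st : E → Bool} {b : Bool}
    (h : e ∉ t.probes (Function.update st e b)) :
    t.probes (Function.update st e b) = t.probes st ∧
      t.matched (Function.update st e b) = t.matched st := by
  refine probes_matched_congr t fun x hx => ?_
  rw [Function.update_of_ne]
  rintro rfl
  exact h hx

theorem NodupProbes.notMem_active {e : E} {a : Bool} {t₀ t₁ : ProbeTree E}
    (h : (probe e a t₀ t₁).NodupProbes) (st : E → Bool) :
    e ∉ t₁.probes (Function.update st e true) := by
  have := h (Function.update st e true)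
  simp only [probes, Function.update_self, if_true, List.nodup_cons] at this
  exact this.1

theorem NodupProbes.notMem_inactive {e : E} {a : Bool} {t₀ t₁ : ProbeTree E}
    (h : (probe e a t₀ t₁).NodupProbes) (st : E → Bool) :
    e ∉ t₀.probes (Function.update st e false) := by
  have := h (Function.update st e false)
  simp only [probes, Function.update_self, Bool.false_eq_true, if_false, List.nodup_cons] at this
  exact this.1

theorem NodupProbes.active {e : E} {a : Bool} {t₀ t₁ : ProbeTree E}
    (h : (probe e a t₀ t₁).NodupProbes) : t₁.NodupProbes := by
  intro st
  rw [← (probes_update_of_notMem (h.notMem_active st)).1]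
  have := h (Function.update st e true)
  simp only [probes, Function.update_self, if_true, List.nodup_cons] at this
  exact this.2

theorem NodupProbes.inactive {e : E} {a : Bool} {t₀ t₁ : ProbeTree E}
    (h : (probe e a t₀ t₁).NodupProbes) : t₀.NodupProbes := by
  intro st
  rw [← (probes_update_of_notMem (h.notMem_inactive st)).1]
  have := h (Function.update st e false)
  simp only [probes, Function.update_self, Bool.false_eq_true, if_false, List.nodup_cons] at this
  exact this.2

/-- The probability that `f` is put into the matching, when every probed edge `e` is active with
probability `p e`, independently of the past. -/
def matchProb (p : E → ℝ) : ProbeTree E → E → ℝ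
  | halt, _ => 0
  | probe e a t₀ t₁, f =>
      p e * ((if a ∧ e = f then 1 else 0) + t₁.matchProb p f) + (1 - p e) * t₀.matchProb p f

theorem matchProb_nonneg {p : E → ℝ} (hp : ∀ e, 0 ≤ p e) (hp' : ∀ e, p e ≤ 1)
    (t : ProbeTree E) (f : E) : 0 ≤ t.matchProb p f := by
  induction t with
  | halt => exact le_rfl
  | probe e a t₀ t₁ ih₀ ih₁ =>
    have h1 := hp e
    have h2 := sub_nonneg.2 (hp' e)
    have h3 : (0 : ℝ) ≤ if a = true ∧ e = f then 1 else 0 := by split_ifs <;> norm_num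
    exact add_nonneg (mul_nonneg h1 (add_nonneg h3 ih₁)) (mul_nonneg h2 ih₀)

end ProbeTree

/-! ### Independent edge states -/

section Independent

variable {E : Type*} [Fintype E] [DecidableEq E]

/-- The probability of the states `st` of independent edges. -/
def stateWeight (p : E → ℝ) (st : E → Bool) : ℝ := ∏ e, if st e then p e else 1 - p e

theorem stateWeight_nonneg {p : E → ℝ} (hp : ∀ e, 0 ≤ p e) (hp' : ∀ e, p e ≤ 1)
    (st : E → Bool) : 0 ≤ stateWeight p st := by
  refine Finset.prod_nonneg fun e _ => ?_
  split_ifs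
  · exact hp e
  · exact sub_nonneg.2 (hp' e)

theorem sum_stateWeight_mul_prod (p : E → ℝ) (g : E → Bool → ℝ) :
    ∑ st, stateWeight p st * ∏ e, g e (st e) = ∏ e, (p e * g e true + (1 - p e) * g e false) := by
  have := (Fintype.prod_sum (κ := fun _ : E => Bool)
    (fun e b => (if b then p e else 1 - p e) * g e b)).symm
  simp only [stateWeight, ← Finset.prod_mul_distrib]
  simpa using this

theorem sum_stateWeight (p : E → ℝ) : ∑ st, stateWeight p st = 1 := by
  simpa using sum_stateWeight_mul_prod p (fun _ _ => 1)

theorem sum_stateWeight_split (p : E → ℝ) (e : E) (F : (E → Bool) → ℝ) :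
    ∑ st, stateWeight p st * F st =
      p e * ∑ st, stateWeight p st * F (Function.update st e true) +
      (1 - p e) * ∑ st, stateWeight p st * F (Function.update st e false) := by
  let R : ({j // j ≠ e} → Bool) → ℝ := fun g => ∏ j, if g j then p j else 1 - p j
  let S : Bool × ({j // j ≠ e} → Bool) → (E → Bool) := (Equiv.funSplitAt e Bool).symm
  have hSe : ∀ b g, S (b, g) e = b := fun b g => by simp [S, Equiv.funSplitAt]
  have hSj : ∀ b g (j : {j // j ≠ e}), S (b, g) j = g j := fun b g j => by
    simp [S, Equiv.funSplitAt, j.2]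
  have hw : ∀ b g, stateWeight p (S (b, g)) = (if b then p e else 1 - p e) * R g := by
    intro b g
    rw [stateWeight, Fintype.prod_eq_mul_prod_subtype_ne _ e, hSe]
    simp only [hSj, R]
  have hu : ∀ b g b', Function.update (S (b, g)) e b' = S (b', g) := by
    intro b g b'
    ext j
    by_cases hj : j = e
    · subst hj; simp [hSe]
    · rw [Function.update_of_ne hj]
      exact (hSj b g ⟨j, hj⟩).trans (hSj b' g ⟨j, hj⟩).symm
  have hsum : ∀ H : (E → Bool) → ℝ, ∑ st, stateWeight p st * H st =
      ∑ g, (p e * R g * H (S (true, g)) + (1 - p e) * R g * H (S (false, g))) := by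
    intro H
    rw [← (Equiv.funSplitAt e Bool).symm.sum_comp, Fintype.sum_prod_type_right]
    refine Finset.sum_congr rfl fun g _ => ?_
    rw [Fintype.sum_bool]
    change stateWeight p (S (true, g)) * H (S (true, g)) +
      stateWeight p (S (false, g)) * H (S (false, g)) = _
    simp [hw]
  rw [hsum, hsum, hsum]
  simp only [hu, Finset.mul_sum, ← Finset.sum_add_distrib]
  refine Finset.sum_congr rfl fun g _ => ?_
  ring

/-- Without repeated probes each probe is a fresh coin, so conditioning on the state of the root
edge reproduces the recursion of `matchProb`. -/
theorem ProbeTree.NodupProbes.sum_stateWeight_matched {t : ProbeTree E} (ht : t.NodupProbes)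
    (p w : E → ℝ) :
    ∑ st, stateWeight p st * ((t.matched st).map w).sum = ∑ f, w f * t.matchProb p f := by
  induction t with
  | halt => simp [ProbeTree.matched, ProbeTree.matchProb]
  | probe e a t₀ t₁ ih₀ ih₁ =>
    rw [sum_stateWeight_split p e]
    have h1 : ∀ st, (((ProbeTree.probe e a t₀ t₁).matched (Function.update st e true)).map w).sum
        = (if a then w e else 0) + ((t₁.matched st).map w).sum := by
      intro st
      rw [← (ProbeTree.probes_update_of_notMem (ht.notMem_active st)).2]
      cases a <;> simp [ProbeTree.matched]
    have h0 : ∀ st, (((ProbeTree.probe e a t₀ t₁).matched (Function.update st e false)).map w).sum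
        = ((t₀.matched st).map w).sum := by
      intro st
      rw [← (ProbeTree.probes_update_of_notMem (ht.notMem_inactive st)).2]
      simp [ProbeTree.matched]
    simp only [h1, h0, ih₀ ht.inactive]
    simp only [mul_add, Finset.sum_add_distrib, ih₁ ht.active, ProbeTree.matchProb,
      ← Finset.sum_mul, sum_stateWeight, Finset.mul_sum]
    have : ∑ f, w f * (p e * if a = true ∧ e = f then 1 else 0) =
        p e * (if a = true then w e else 0) := by
      cases a <;> simp [mul_comm]
    rw [this]
    simp only [mul_left_comm (w _)]
    ring

end Independent

/-! ### Non-adaptive simulation at a single online vertex -/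

namespace StochasticGraph

variable {U V : Type*} [DecidableEq U] [DecidableEq V]

theorem Feasible.nodupProbes {G : StochasticGraph U V} {t : ProbeTree (U × V)}
    (ht : G.Feasible t) : t.NodupProbes := by
  intro st
  rw [List.nodup_iff_count_le_one]
  intro e
  have h := G.nodup_of_mem _ _ ((ht st).1 e.2)
  rw [List.nodup_iff_count_le_one] at h
  simpa [List.count_filter] using h e

/-- The probability that `f` is the first active edge among the edges of `L` marked `true`,
and that `f` satisfies `A`. -/
def proposeProb (p : U × V → ℝ) (A : U × V → Bool) : List ((U × V) × Bool) → U × V → ℝ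
  | [], _ => 0
  | (e, true) :: L, f =>
      p e * (if A e ∧ e = f then 1 else 0) + (1 - p e) * proposeProb p A L f
  | (_, false) :: L, f => proposeProb p A L f

/-- A first active edge that fails `A` ends the search without a proposal. Hence `A` acts as a
coordinatewise factor, which makes attenuation linear. -/
theorem proposeProb_eq_ite (p : U × V → ℝ) (A : U × V → Bool) (L : List ((U × V) × Bool))
    (f : U × V) :
    proposeProb p A L f = (if A f then 1 else 0) * proposeProb p (fun _ => true) L f := by
  induction L with
  | nil => simp [proposeProb]
  | cons x L ih =>
    rcases x with ⟨e, _ | _⟩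
    · simpa [proposeProb] using ih
    · simp only [proposeProb, ih, true_and]
      by_cases hef : e = f
      · subst hef; cases A e <;> simp
      · simp only [hef, and_false, if_false]; ring

theorem proposeProb_mem_Icc {p : U × V → ℝ} (hp : ∀ e, 0 ≤ p e) (hp' : ∀ e, p e ≤ 1)
    (A : U × V → Bool) (L : List ((U × V) × Bool)) (f : U × V) :
    0 ≤ proposeProb p A L f ∧ proposeProb p A L f ≤ 1 := by
  induction L with
  | nil => simp [proposeProb]
  | cons x L ih =>
    rcases x with ⟨e, _ | _⟩
    · exact ih
    · simp only [proposeProb]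
      have h1 := hp e
      have h2 := hp' e
      split_ifs <;> constructor <;> nlinarith

theorem proposeProb_eq_zero_of_ne {p : U × V → ℝ} {A : U × V → Bool}
    {L : List ((U × V) × Bool)} {v : V} (hL : ∀ x ∈ L, x.1.2 = v) {f : U × V} (hf : f.2 ≠ v) :
    proposeProb p A L f = 0 := by
  induction L with
  | nil => rfl
  | cons x L ih =>
    have ih := ih fun y hy => hL y (List.mem_cons_of_mem _ hy)
    rcases x with ⟨e, _ | _⟩
    · exact ih
    · have hef : e ≠ f := by
        rintro rfl
        exact hf (hL _ List.mem_cons_self)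
      simp [proposeProb, hef, ih]

/-- The vectors of proposal probabilities of the non-adaptive policies at `v` which extend the
string `s` of edges that have been probed already. -/
def proposeVectors (G : StochasticGraph U V) (v : V) (s : List (U × V)) : Set (U → ℝ) :=
  {x | ∃ L : List ((U × V) × Bool), s ++ L.map Prod.fst ∈ G.C v ∧
    x = fun u => proposeProb G.p (fun _ => true) L (u, v)}

theorem matchProb_eq_zero_of_notMem {p : U × V → ℝ} {t : ProbeTree (U × V)} (hn : t.NodupProbes)
    {f : U × V} (h : ∀ st, f ∉ t.matched st) : t.matchProb p f = 0 := by
  induction t with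
  | halt => rfl
  | probe e a t₀ t₁ ih₀ ih₁ =>
    have h1 : ∀ st, ¬ (a = true ∧ e = f) ∧ f ∉ t₁.matched st := by
      intro st
      have := h (Function.update st e true)
      rw [ProbeTree.matched, Function.update_self, if_pos rfl,
        (ProbeTree.probes_update_of_notMem (hn.notMem_active st)).2] at this
      cases a
      · simpa using this
      · rw [if_pos rfl, List.mem_cons, not_or] at this
        exact ⟨fun h => this.1 h.2.symm, this.2⟩
    have h0 : ∀ st, f ∉ t₀.matched st := by
      intro st
      have := h (Function.update st e false)
      rwa [ProbeTree.matched, Function.update_self, if_neg (by simp),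
        (ProbeTree.probes_update_of_notMem (hn.notMem_inactive st)).2] at this
    rw [ProbeTree.matchProb, ih₀ hn.inactive h0, ih₁ hn.active fun st => (h1 st).2,
      if_neg (h1 fun _ => true).1]
    simp

/-- Only one edge at `v` can be accepted, so up to that moment every probed edge at `v` either would
have been accepted and was inactive, or was probed for information only. The latter, like edges at
other vertices, can be replaced by private coins, which is a convex combination. -/
theorem matchProb_mem_convexHull (G : StochasticGraph U V) (v : V) (t : ProbeTree (U × V))
    (s : List (U × V)) (hn : t.NodupProbes)
    (hC : ∀ st, s ++ (t.probes st).filter (fun e => e.2 = v) ∈ G.C v)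
    (hm : ∀ st, (t.matched st).Pairwise fun e f => e.2 ≠ f.2) :
    (fun u => t.matchProb G.p (u, v)) ∈ convexHull ℝ (G.proposeVectors v s) := by
  induction t generalizing s with
  | halt =>
    refine subset_convexHull _ _ ⟨[], ?_, rfl⟩
    simpa [ProbeTree.probes] using hC fun _ => false
  | probe e a t₀ t₁ ih₀ ih₁ =>
    have hp := G.p_nonneg e
    have hp' := G.p_le_one e
    have hp1 : ∀ st, (ProbeTree.probe e a t₀ t₁).probes (Function.update st e true) =
        e :: t₁.probes st := by
      intro st
      rw [ProbeTree.probes, Function.update_self, if_pos rfl,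
        (ProbeTree.probes_update_of_notMem (hn.notMem_active st)).1]
    have hp0 : ∀ st, (ProbeTree.probe e a t₀ t₁).probes (Function.update st e false) =
        e :: t₀.probes st := by
      intro st
      rw [ProbeTree.probes, Function.update_self, if_neg (by simp),
        (ProbeTree.probes_update_of_notMem (hn.notMem_inactive st)).1]
    have hm1 : ∀ st, (if a then e :: t₁.matched st else t₁.matched st).Pairwise
        fun e f => e.2 ≠ f.2 := by
      intro st
      have := hm (Function.update st e true)
      rwa [ProbeTree.matched, Function.update_self, if_pos rfl,
        (ProbeTree.probes_update_of_notMem (hn.notMem_active st)).2] at this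
    have hm1' : ∀ st, (t₁.matched st).Pairwise fun e f => e.2 ≠ f.2 := by
      intro st
      have := hm1 st
      cases a
      · simpa using this
      · exact (List.pairwise_cons.1 (by simpa using this)).2
    have hm0 : ∀ st, (t₀.matched st).Pairwise fun e f => e.2 ≠ f.2 := by
      intro st
      have := hm (Function.update st e false)
      rwa [ProbeTree.matched, Function.update_self, if_neg (by simp),
        (ProbeTree.probes_update_of_notMem (hn.notMem_inactive st)).2] at this
    have hC1 : ∀ st, s ++ (e :: t₁.probes st).filter (fun e => e.2 = v) ∈ G.C v := by
      intro st
      rw [← hp1]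
      exact hC _
    have hC0 : ∀ st, s ++ (e :: t₀.probes st).filter (fun e => e.2 = v) ∈ G.C v := by
      intro st
      rw [← hp0]
      exact hC _
    by_cases hev : e.2 = v
    · have hC1' : ∀ st, (s ++ [e]) ++ (t₁.probes st).filter (fun e => e.2 = v) ∈ G.C v := by
        intro st
        simpa [hev] using hC1 st
      have hC0' : ∀ st, (s ++ [e]) ++ (t₀.probes st).filter (fun e => e.2 = v) ∈ G.C v := by
        intro st
        simpa [hev] using hC0 st
      have h0 := ih₀ (s ++ [e]) hn.inactive hC0' hm0
      cases a with
      | false =>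
        have h1 := ih₁ (s ++ [e]) hn.active hC1' hm1'
        have hsub : convexHull ℝ (G.proposeVectors v (s ++ [e])) ⊆
            convexHull ℝ (G.proposeVectors v s) := by
          refine convexHull_mono ?_
          rintro x ⟨L, hL, rfl⟩
          -- A probe that cannot be accepted stays in the string, unmarked, so that the string
          -- remains in `G.C v`.
          exact ⟨(e, false) :: L, by simpa using hL, rfl⟩
        have := convex_convexHull ℝ (G.proposeVectors v s) (hsub h1) (hsub h0) hp
          (sub_nonneg.2 hp') (by ring)
        convert this using 1
        ext u
        simp [ProbeTree.matchProb]
      | true =>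
        -- Once `e` is accepted, `v` is matched and the active branch contributes nothing more at
        -- `v`.
        have hz : ∀ u, t₁.matchProb G.p (u, v) = 0 := by
          refine fun u => matchProb_eq_zero_of_notMem hn.active fun st hmem => ?_
          have := hm1 st
          rw [if_pos rfl, List.pairwise_cons] at this
          exact this.1 _ hmem hev
        -- The effect on proposal vectors of putting the marked edge `e` in front of a policy; being
        -- affine, it respects convex hulls.
        let φ : (U → ℝ) →ᵃ[ℝ] (U → ℝ) :=
          AffineMap.const ℝ _ (fun u => G.p e * (if e = (u, v) then 1 else 0)) +
            ((1 - G.p e) • LinearMap.id (R := ℝ) (M := U → ℝ)).toAffineMap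
        have hφ : ∀ x u, φ x u = G.p e * (if e = (u, v) then 1 else 0) + (1 - G.p e) * x u := by
          intro x u
          simp [φ]
        have hsub : convexHull ℝ (G.proposeVectors v (s ++ [e])) ⊆
            φ ⁻¹' convexHull ℝ (G.proposeVectors v s) := by
          refine convexHull_min ?_ ((convex_convexHull ℝ _).affine_preimage φ)
          rintro x ⟨L, hL, rfl⟩
          refine subset_convexHull _ _ ⟨(e, true) :: L, by simpa using hL, ?_⟩
          ext u
          simp [hφ, proposeProb]
        have hmem : φ _ ∈ convexHull ℝ (G.proposeVectors v s) := hsub h0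
        convert hmem using 1
        ext u
        simp [hφ, ProbeTree.matchProb, hz]
    · have h1 := ih₁ s hn.active (fun st => by simpa [hev] using hC1 st) hm1'
      have h0 := ih₀ s hn.inactive (fun st => by simpa [hev] using hC0 st) hm0
      have := convex_convexHull ℝ (G.proposeVectors v s) h1 h0 hp (sub_nonneg.2 hp') (by ring)
      convert this using 1
      ext u
      have : e ≠ (u, v) := fun h => hev (by rw [h])
      simp [ProbeTree.matchProb, this]

end StochasticGraph

/-! ### Multi-affine functions and derandomization -/

/-- `F` is affine in each of its arguments. -/
def IsMultiAffine {ι X : Type*} [DecidableEq ι] [AddCommGroup X] [Module ℝ X]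
    (F : (ι → X) → ℝ) : Prop :=
  ∀ (z : ι → X) (i : ι) (x y : X) (a b : ℝ), a + b = 1 →
    F (Function.update z i (a • x + b • y)) =
      a * F (Function.update z i x) + b * F (Function.update z i y)

section MultiAffine

variable {ι X : Type*} [DecidableEq ι] [AddCommGroup X] [Module ℝ X]

theorem IsMultiAffine.sum {κ : Type*} {s : Finset κ} {F : κ → (ι → X) → ℝ}
    (h : ∀ k ∈ s, IsMultiAffine (F k)) : IsMultiAffine fun z => ∑ k ∈ s, F k z := by
  intro z i x y a b hab
  simp only [Finset.mul_sum, ← Finset.sum_add_distrib]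
  exact Finset.sum_congr rfl fun k hk => h k hk z i x y a b hab

theorem IsMultiAffine.const_mul {F : (ι → X) → ℝ} (h : IsMultiAffine F) (c : ℝ) :
    IsMultiAffine fun z => c * F z := by
  intro z i x y a b hab
  simp only [h z i x y a b hab]
  ring

theorem isMultiAffine_prod [Fintype ι] {g : ι → X → ℝ}
    (h : ∀ i x y (a b : ℝ), a + b = 1 → g i (a • x + b • y) = a * g i x + b * g i y) :
    IsMultiAffine fun z => ∏ i, g i (z i) := by
  intro z i x y a b hab
  have key : ∀ x, ∏ j, g j (Function.update z i x j) =
      g i x * ∏ j : {j // j ≠ i}, g j (z j) := by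
    intro x
    rw [Fintype.prod_eq_mul_prod_subtype_ne _ i, Function.update_self]
    congr 1
    exact Finset.prod_congr rfl fun j _ => by rw [Function.update_of_ne j.2]
  simp only [key, h i x y a b hab]
  ring

/-- Move one argument at a time to a generator of its hull: an affine function at a convex
combination is at most its value at one of the points. -/
theorem IsMultiAffine.exists_ge_of_mem_convexHull [Fintype ι] {F : (ι → X) → ℝ}
    (hF : IsMultiAffine F) {S : ι → Set X} {z : ι → X} (hz : ∀ i, z i ∈ convexHull ℝ (S i)) :
    ∃ y : ι → X, (∀ i, y i ∈ S i) ∧ F z ≤ F y := by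
  suffices H : ∀ T : Finset ι, ∃ y : ι → X, (∀ i ∈ T, y i ∈ S i) ∧ (∀ i ∉ T, y i = z i) ∧
      F z ≤ F y by
    obtain ⟨y, h1, -, h2⟩ := H Finset.univ
    exact ⟨y, fun i => h1 i (Finset.mem_univ i), h2⟩
  intro T
  induction T using Finset.induction_on with
  | empty => exact ⟨z, by simp, fun _ _ => rfl, le_rfl⟩
  | insert i T hi ih =>
    obtain ⟨y, h1, h2, h3⟩ := ih
    have hconv : ConvexOn ℝ Set.univ fun x => F (Function.update y i x) :=
      ⟨convex_univ, fun x _ x' _ a b _ _ hab => (hF y i x x' a b hab).le⟩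
    have hi' : y i ∈ convexHull ℝ (S i) := h2 i hi ▸ hz i
    obtain ⟨x, hx, hle⟩ := hconv.exists_ge_of_mem_convexHull (Set.subset_univ _) hi'
    rw [Function.update_eq_self] at hle
    refine ⟨Function.update y i x, ?_, ?_, h3.trans hle⟩
    · intro j hj
      by_cases hji : j = i
      · subst hji; simpa using hx
      · rw [Function.update_of_ne hji]
        exact h1 j ((Finset.mem_insert.1 hj).resolve_left hji)
    · intro j hj
      rw [Finset.mem_insert, not_or] at hj
      rw [Function.update_of_ne hj.1]
      exact h2 j hj.2

end MultiAffine

/-- Coordinatewise scaling by factors in `[0, 1]` is an average of coordinate projections. -/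
theorem mul_mem_convexHull_of_mem_Icc {U : Type*} [Finite U] {S : Set (U → ℝ)} {m a : U → ℝ}
    (hm : m ∈ convexHull ℝ S) (ha : ∀ u, a u ∈ Set.Icc (0 : ℝ) 1) :
    a * m ∈ convexHull ℝ {y | ∃ x ∈ S, ∃ A : U → Bool,
      (∀ u, A u = true → a u ≠ 0) ∧ y = (fun u => if A u then 1 else 0) * x} := by
  set T := {y | ∃ x ∈ S, ∃ A : U → Bool,
      (∀ u, A u = true → a u ≠ 0) ∧ y = (fun u => if A u then (1 : ℝ) else 0) * x}
  -- Shrinking the cube to `{0}` where `a` vanishes is what prevents `A` from admitting such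
  -- coordinates.
  have h1 : a ∈ convexHull ℝ (Set.univ.pi fun u => if a u = 0 then {0} else ({0, 1} : Set ℝ)) := by
    rw [convexHull_pi]
    intro u _
    dsimp only
    split_ifs with h
    · simp [h]
    · rw [convexHull_pair, segment_eq_Icc zero_le_one]
      exact ha u
  have h2 : ∀ b ∈ (Set.univ.pi fun u => if a u = 0 then {0} else ({0, 1} : Set ℝ)),
      b * m ∈ convexHull ℝ T := by
    intro b hb
    have hsub : convexHull ℝ S ⊆ LinearMap.mulLeft ℝ b ⁻¹' convexHull ℝ T := by
      refine convexHull_min ?_ ((convex_convexHull ℝ T).linear_preimage _)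
      intro x hx
      refine subset_convexHull ℝ T ⟨x, hx, fun u => decide (b u = 1), ?_, ?_⟩
      · intro u hu h0
        have := hb u trivial
        simp only [h0, if_true, Set.mem_singleton_iff] at this
        simp [this] at hu
      · rw [LinearMap.mulLeft_apply]
        congr 1
        ext u
        have := hb u trivial
        dsimp only at this
        split_ifs at this with h
        · rw [Set.mem_singleton_iff] at this
          simp [this]
        · rcases this with h | h
          · simp [h]
          · rw [Set.mem_singleton_iff] at h
            simp [h]
    exact hsub hm
  have h3 : (Set.univ.pi fun u => if a u = 0 then {0} else ({0, 1} : Set ℝ)) ⊆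
      LinearMap.mulRight ℝ m ⁻¹' convexHull ℝ T := h2
  exact convexHull_min h3 ((convex_convexHull ℝ T).linear_preimage _) h1

/-! ### Proposals at random times -/

namespace StochasticGraph

variable {U V : Type*} [DecidableEq U] [DecidableEq V]

/-- The probabilities, for `u : U` and `j : Fin N`, that `v` proposes to `u` at time `j`, for the
deterministic choices of a time, a string in `C v` and the edges which may be accepted, all of
nonnegative weight. -/
def timedVectors (G : StochasticGraph U V) (N : ℕ) (v : V) : Set (U → Fin N → ℝ) :=
  {z | ∃ (k : Fin N) (L : List ((U × V) × Bool)) (A : U × V → Bool),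
    L.map Prod.fst ∈ G.C v ∧ (∀ e, A e = true → 0 ≤ G.w e) ∧
    z = fun u j => if j = k then proposeProb G.p A L (u, v) else 0}

/-- The factor `1 / N` is the uniform choice of the time `k`; at time `k`, attenuation by `a · k` is
a random choice of the set `A`. -/
theorem smul_mem_convexHull_timedVectors [Finite U] (G : StochasticGraph U V) {N : ℕ}
    (hN : N ≠ 0) (v : V) {m : U → ℝ} (hm : m ∈ convexHull ℝ (G.proposeVectors v []))
    {a : U → Fin N → ℝ} (ha : ∀ u j, a u j ∈ Set.Icc (0 : ℝ) 1)
    (hw : ∀ u j, G.w (u, v) < 0 → a u j = 0) :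
    (fun u j => (1 / N : ℝ) * (a u j * m u)) ∈ convexHull ℝ (G.timedVectors N v) := by
  have hN' : (N : ℝ) ≠ 0 := Nat.cast_ne_zero.2 hN
  have key : ∀ k : Fin N, (fun u j => if j = k then a u k * m u else 0) ∈
      convexHull ℝ (G.timedVectors N v) := by
    intro k
    let φ : (U → ℝ) →ₗ[ℝ] (U → Fin N → ℝ) :=
      { toFun := fun x u j => if j = k then x u else 0
        map_add' := by intro x y; ext u j; by_cases h : j = k <;> simp [h]
        map_smul' := by intro c x; ext u j; by_cases h : j = k <;> simp [h] }
    have h1 := mul_mem_convexHull_of_mem_Icc hm (fun u => ha u k)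
    refine convexHull_min (t := φ ⁻¹' convexHull ℝ (G.timedVectors N v)) ?_
      ((convex_convexHull ℝ _).linear_preimage φ) h1
    rintro y ⟨x, ⟨L, hL, rfl⟩, A, hA, rfl⟩
    -- The test `e.2 = v` is needed because `hw` controls the weights of edges at `v` only.
    refine subset_convexHull _ _ ⟨k, L, fun e => A e.1 && decide (e.2 = v), by simpa using hL,
      ?_, ?_⟩
    · intro e he
      by_contra hneg
      simp only [Bool.and_eq_true, decide_eq_true_eq] at he
      refine hA e.1 he.1 (hw e.1 k ?_)
      rw [← he.2]
      exact not_le.1 hneg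
    · ext u j
      simp only [φ, LinearMap.coe_mk, AddHom.coe_mk, Pi.mul_apply]
      rw [proposeProb_eq_ite G.p (fun e => A e.1 && decide (e.2 = v))]
      simp
  have h2 := (convex_convexHull ℝ (G.timedVectors N v)).sum_mem
    (t := Finset.univ) (w := fun _ : Fin N => (1 / N : ℝ)) (fun _ _ => by positivity)
    (by simp [hN']) (fun k _ => key k)
  convert h2 using 1
  ext u j
  simp [Finset.sum_apply]

end StochasticGraph

/-! ### Non-adaptive block strategies -/

namespace StochasticGraph

variable {U V : Type*} [DecidableEq U] [DecidableEq V]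

/-- Probe all of `L` without accepting anything, then continue with `t`. -/
def probeAll : List (U × V) → ProbeTree (U × V) → ProbeTree (U × V)
  | [], t => t
  | e :: L, t => .probe e false (probeAll L t) (probeAll L t)

/-- Probe the string `L`. The first active edge among those marked `true` is accepted if it
satisfies `A` and its offline vertex is not in `used`. Then continue with `rest`, given the
new set of used offline vertices. -/
def probeBlock (A : U × V → Bool) (rest : Finset U → ProbeTree (U × V)) (used : Finset U) :
    List ((U × V) × Bool) → ProbeTree (U × V)
  | [] => rest used
  | (e, false) :: L => .probe e false (probeBlock A rest used L) (probeBlock A rest used L)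
  | (e, true) :: L =>
      .probe e (A e && decide (e.1 ∉ used)) (probeBlock A rest used L)
        (probeAll (L.map Prod.fst) (rest (if A e then insert e.1 used else used)))

/-- The non-adaptive strategy which treats the online vertices of a list one after the other. -/
def blockTree (L : V → List ((U × V) × Bool)) (A : V → U × V → Bool) :
    List V → Finset U → ProbeTree (U × V)
  | [], _ => .halt
  | v :: vs, used => probeBlock (A v) (blockTree L A vs) used (L v)

theorem probes_probeAll (L : List (U × V)) (t : ProbeTree (U × V)) (st : U × V → Bool) :
    (probeAll L t).probes st = L ++ t.probes st := by
  induction L with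
  | nil => rfl
  | cons e L ih => simp [probeAll, ProbeTree.probes, ih]

theorem matched_probeAll (L : List (U × V)) (t : ProbeTree (U × V)) (st : U × V → Bool) :
    (probeAll L t).matched st = t.matched st := by
  induction L with
  | nil => rfl
  | cons e L ih => simp [probeAll, ProbeTree.matched, ih]

theorem matchProb_probeAll (p : U × V → ℝ) (L : List (U × V)) (t : ProbeTree (U × V))
    (f : U × V) : (probeAll L t).matchProb p f = t.matchProb p f := by
  induction L with
  | nil => rfl
  | cons e L ih =>
    simp only [probeAll, ProbeTree.matchProb, ih]
    simp
    ring

theorem probes_probeBlock {A : U × V → Bool} {rest : Finset U → ProbeTree (U × V)}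
    {used : Finset U} {L : List ((U × V) × Bool)} {st : U × V → Bool} {P : List (U × V)}
    (h : ∀ used, (rest used).probes st = P) :
    (probeBlock A rest used L).probes st = L.map Prod.fst ++ P := by
  induction L with
  | nil => exact h used
  | cons x L ih =>
    rcases x with ⟨e, _ | _⟩ <;> simp [probeBlock, ProbeTree.probes, probes_probeAll, ih, h]

theorem probes_blockTree (L : V → List ((U × V) × Bool)) (A : V → U × V → Bool) (vs : List V)
    (used : Finset U) (st : U × V → Bool) :
    (blockTree L A vs used).probes st = vs.flatMap fun v => (L v).map Prod.fst := by
  induction vs generalizing used with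
  | nil => rfl
  | cons v vs ih => simpa [blockTree] using probes_probeBlock ih

theorem nonAdaptive_blockTree (L : V → List ((U × V) × Bool)) (A : V → U × V → Bool)
    (vs : List V) (used : Finset U) : (blockTree L A vs used).NonAdaptive := by
  intro st st'
  rw [probes_blockTree, probes_blockTree]

theorem pairwise_matched_probeBlock {A : U × V → Bool} {rest : Finset U → ProbeTree (U × V)}
    {used : Finset U} {L : List ((U × V) × Bool)} {st : U × V → Bool} {v : V}
    (hL : ∀ x ∈ L, x.1.2 = v)
    (h : ∀ used, (∀ e ∈ (rest used).matched st, e.1 ∉ used ∧ e.2 ≠ v) ∧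
      ((rest used).matched st).Pairwise fun e f => e.1 ≠ f.1 ∧ e.2 ≠ f.2) :
    (∀ e ∈ (probeBlock A rest used L).matched st, e.1 ∉ used) ∧
      ((probeBlock A rest used L).matched st).Pairwise fun e f => e.1 ≠ f.1 ∧ e.2 ≠ f.2 := by
  induction L with
  | nil => exact ⟨fun e he => ((h used).1 e he).1, (h used).2⟩
  | cons x L ih =>
    have ih := ih fun y hy => hL y (List.mem_cons_of_mem _ hy)
    have hx := hL x List.mem_cons_self
    rcases x with ⟨e, _ | _⟩
    · simpa [probeBlock, ProbeTree.matched] using ih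
    · by_cases hs : st e = true
      · simp only [probeBlock, ProbeTree.matched, hs, if_true, matched_probeAll]
        by_cases hA : A e = true
        · have hr := h (insert e.1 used)
          by_cases hu : e.1 ∈ used
          · simp only [hA, hu, not_true_eq_false, decide_false, Bool.and_false,
              Bool.false_eq_true, if_false, if_true]
            exact ⟨fun f hf hfu => (hr.1 f hf).1 (Finset.mem_insert_of_mem hfu), hr.2⟩
          · simp only [hA, hu, not_false_eq_true, decide_true, Bool.and_true, if_true,
              List.mem_cons, List.pairwise_cons]
            refine ⟨?_, ?_, hr.2⟩
            · rintro f (rfl | hf)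
              · exact hu
              · exact fun hfu => (hr.1 f hf).1 (Finset.mem_insert_of_mem hfu)
            · intro f hf
              refine ⟨fun hef => (hr.1 f hf).1 ?_, fun hef => (hr.1 f hf).2 ?_⟩
              · rw [← hef]; exact Finset.mem_insert_self _ _
              · rw [← hef]; exact hx
        · simp only [hA, Bool.false_and, Bool.false_eq_true, if_false]
          exact ⟨fun f hf => ((h used).1 f hf).1, (h used).2⟩
      · simpa [probeBlock, ProbeTree.matched, hs] using ih

theorem pairwise_matched_blockTree {L : V → List ((U × V) × Bool)} (A : V → U × V → Bool)
    (hL : ∀ v, ∀ x ∈ L v, x.1.2 = v) {vs : List V} (hvs : vs.Nodup) (used : Finset U)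
    (st : U × V → Bool) :
    (∀ e ∈ (blockTree L A vs used).matched st, e.1 ∉ used) ∧
      ((blockTree L A vs used).matched st).Pairwise fun e f => e.1 ≠ f.1 ∧ e.2 ≠ f.2 := by
  induction vs generalizing used with
  | nil => simp [blockTree, ProbeTree.matched]
  | cons v vs ih =>
    rw [List.nodup_cons] at hvs
    refine pairwise_matched_probeBlock (hL v) fun used => ⟨fun e he => ⟨(ih hvs.2 used).1 e he, ?_⟩,
      (ih hvs.2 used).2⟩
    have he := (ProbeTree.matched_sublist_probes _ _).subset he
    rw [probes_blockTree, List.mem_flatMap] at he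
    obtain ⟨v', hv', he⟩ := he
    obtain ⟨x, hx, rfl⟩ := List.mem_map.1 he
    rw [hL v' x hx]
    rintro rfl
    exact hvs.1 hv'

theorem filter_flatMap_blocks {L : V → List ((U × V) × Bool)}
    (hL : ∀ v, ∀ x ∈ L v, x.1.2 = v) {vs : List V} (hvs : vs.Nodup) (v : V) :
    (vs.flatMap fun v => (L v).map Prod.fst).filter (fun e => e.2 = v) =
      if v ∈ vs then (L v).map Prod.fst else [] := by
  induction vs with
  | nil => rfl
  | cons v' vs ih =>
    rw [List.nodup_cons] at hvs
    rw [List.flatMap_cons, List.filter_append, ih hvs.2]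
    by_cases hv : v = v'
    · subst hv
      rw [List.filter_eq_self.2]
      · simp [hvs.1]
      · intro e he
        obtain ⟨x, hx, rfl⟩ := List.mem_map.1 he
        simpa using hL v x hx
    · rw [List.filter_eq_nil_iff.2]
      · simp [hv]
      · intro e he
        obtain ⟨x, hx, rfl⟩ := List.mem_map.1 he
        rw [hL v' x hx]
        simpa using Ne.symm hv

theorem feasible_blockTree (G : StochasticGraph U V) {L : V → List ((U × V) × Bool)}
    (hC : ∀ v, (L v).map Prod.fst ∈ G.C v) (A : V → U × V → Bool) {vs : List V} (hvs : vs.Nodup)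
    (used : Finset U) : G.Feasible (blockTree L A vs used) := by
  have hL : ∀ v, ∀ x ∈ L v, x.1.2 = v := fun v x hx =>
    G.incident_of_mem v _ (hC v) _ (List.mem_map_of_mem hx)
  refine fun st => ⟨fun v => ?_, (pairwise_matched_blockTree A hL hvs used st).2⟩
  rw [probes_blockTree, filter_flatMap_blocks hL hvs]
  split_ifs
  · exact hC v
  · exact G.nil_mem v

/-- Within the block at most one proposal is made, and it affects the later fate of `f` only if it
goes to `f.1`. -/
theorem matchProb_probeBlock {p : U × V → ℝ} {A : U × V → Bool}
    {rest : Finset U → ProbeTree (U × V)} {used : Finset U} {L : List ((U × V) × Bool)} {v : V}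
    (hL : ∀ x ∈ L, x.1.2 = v) {f : U × V} {r : ℝ}
    (h : ∀ used, (rest used).matchProb p f = (if f.1 ∈ used then 0 else 1) * r) :
    (probeBlock A rest used L).matchProb p f = (if f.1 ∈ used then 0 else 1) *
      (proposeProb p A L f + (1 - proposeProb p A L (f.1, v)) * r) := by
  induction L with
  | nil => simp [probeBlock, proposeProb, h]
  | cons x L ih =>
    have ih := ih fun y hy => hL y (List.mem_cons_of_mem _ hy)
    have hx := hL x List.mem_cons_self
    rcases x with ⟨e, _ | _⟩
    · simp only [probeBlock, ProbeTree.matchProb, proposeProb, ih, Bool.false_eq_true, false_and,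
        if_false]
      ring
    · simp only [probeBlock, ProbeTree.matchProb, proposeProb, ih, matchProb_probeAll, h]
      by_cases hA : A e = true
      · by_cases hu : e.1 = f.1
        · have hef : e = (f.1, v) := Prod.ext hu hx
          by_cases hf : f.1 ∈ used
          · simp [hA, hu, hf]
          · simp only [hA, hu, hf, hef.symm]
            simp
            ring
        · have h1 : e ≠ f := fun h => hu (by rw [h])
          have h2 : e ≠ (f.1, v) := fun h => hu (by rw [h])
          have h3 : f.1 ∈ insert e.1 used ↔ f.1 ∈ used := by simp [Ne.symm hu]
          simp only [hA, h1, h2, h3, and_false, if_false, if_true]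
          ring
      · simp only [hA, Bool.false_and, Bool.false_eq_true, false_and, if_false]
        ring

/-- The probability that `f` is matched by the strategy `blockTree`, where `q v` are the proposal
probabilities of `v`. -/
def blockProb (q : V → U × V → ℝ) : List V → U × V → ℝ
  | [], _ => 0
  | v :: vs, f => q v f + (1 - q v (f.1, v)) * blockProb q vs f

theorem matchProb_blockTree (p : U × V → ℝ) {L : V → List ((U × V) × Bool)}
    (A : V → U × V → Bool) (hL : ∀ v, ∀ x ∈ L v, x.1.2 = v) (vs : List V) (used : Finset U)
    (f : U × V) :
    (blockTree L A vs used).matchProb p f = (if f.1 ∈ used then 0 else 1) *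
      blockProb (fun v => proposeProb p (A v) (L v)) vs f := by
  induction vs generalizing used with
  | nil => simp [blockTree, ProbeTree.matchProb, blockProb]
  | cons v vs ih => exact matchProb_probeBlock (hL v) ih

theorem blockProb_eq_zero {q : V → U × V → ℝ} (hq : ∀ v f, f.2 ≠ v → q v f = 0) (vs : List V)
    {f : U × V} (hf : q f.2 f = 0) : blockProb q vs f = 0 := by
  induction vs with
  | nil => rfl
  | cons v vs ih =>
    rw [blockProb, ih, mul_zero, add_zero]
    by_cases h : f.2 = v
    · rw [← h, hf]
    · exact hq v f h

theorem blockProb_nonneg {q : V → U × V → ℝ} (hq : ∀ v f, q v f ∈ Set.Icc (0 : ℝ) 1)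
    (vs : List V) (f : U × V) : 0 ≤ blockProb q vs f := by
  induction vs with
  | nil => exact le_rfl
  | cons v vs ih => exact add_nonneg (hq v f).1 (mul_nonneg (sub_nonneg.2 (hq v _).2) ih)

/-- If `f.2` proposes along `f` and nobody earlier proposed to `f.1`, then `f` is matched. Vertices
tied with `f.2` are counted as earlier, which only lowers the bound and makes it independent of
tie-breaking. -/
theorem le_blockProb {q : V → U × V → ℝ} (hq : ∀ v f, q v f ∈ Set.Icc (0 : ℝ) 1)
    {κ : Type*} [LinearOrder κ] (k : V → κ) {vs : List V}
    (hs : vs.Pairwise fun v v' => k v ≤ k v') {f : U × V} (hf : f.2 ∈ vs) :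
    q f.2 f * (vs.map fun v => if v ≠ f.2 ∧ k v ≤ k f.2 then 1 - q v (f.1, v) else 1).prod ≤
      blockProb q vs f := by
  induction vs with
  | nil => simp at hf
  | cons v vs ih =>
    rw [List.pairwise_cons] at hs
    have hprod : ∀ vs : List V, 0 ≤ (vs.map fun v => if v ≠ f.2 ∧ k v ≤ k f.2 then
        1 - q v (f.1, v) else 1).prod ∧ (vs.map fun v => if v ≠ f.2 ∧ k v ≤ k f.2 then
        1 - q v (f.1, v) else 1).prod ≤ 1 := by
      intro vs
      induction vs with
      | nil => simp
      | cons v vs ih =>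
        have h1 := hq v (f.1, v)
        rw [List.map_cons, List.prod_cons]
        split_ifs
        · exact ⟨mul_nonneg (sub_nonneg.2 h1.2) ih.1,
            mul_le_one₀ (by linarith [h1.1]) ih.1 ih.2⟩
        · simpa using ih
    by_cases h : f.2 = v
    · calc _ ≤ q f.2 f * 1 := mul_le_mul_of_nonneg_left (hprod _).2 (hq _ _).1
        _ ≤ q v f + (1 - q v (f.1, v)) * blockProb q vs f := by
          rw [mul_one, h]
          exact le_add_of_nonneg_right
            (mul_nonneg (sub_nonneg.2 (hq _ _).2) (blockProb_nonneg hq vs f))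
    · have hf' : f.2 ∈ vs := (List.mem_cons.1 hf).resolve_left h
      rw [List.map_cons, List.prod_cons, if_pos ⟨Ne.symm h, hs.1 _ hf'⟩, blockProb,
        mul_left_comm]
      exact (mul_le_mul_of_nonneg_left (ih hs.2 hf') (sub_nonneg.2 (hq v _).2)).trans
        (le_add_of_nonneg_left (hq v f).1)

end StochasticGraph

/-! ### Elementary inequalities and sorting -/

theorem one_sub_one_div_exp_pos : 0 < 1 - 1 / Real.exp 1 := by
  rw [sub_pos, div_lt_one (Real.exp_pos 1)]
  exact Real.one_lt_exp_iff.2 one_pos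

theorem one_sub_sum_le_prod {ι : Type*} (s : Finset ι) {x : ι → ℝ} (h0 : ∀ i, 0 ≤ x i)
    (h1 : ∀ i, x i ≤ 1) : 1 - ∑ i ∈ s, x i ≤ ∏ i ∈ s, (1 - x i) := by
  classical
  induction s using Finset.induction_on with
  | empty => simp
  | insert i s hi ih =>
    rw [Finset.sum_insert hi, Finset.prod_insert hi]
    have : 0 ≤ ∑ i ∈ s, x i := Finset.sum_nonneg fun i _ => h0 i
    nlinarith [h0 i, h1 i, mul_le_mul_of_nonneg_left ih (sub_nonneg.2 (h1 i)),
      mul_nonneg (h0 i) this]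

theorem sum_Iic_geom {N : ℕ} (k : Fin N) (x : ℝ) :
    ∑ j ∈ Finset.Iic k, (1 - x) * x ^ (j : ℕ) = 1 - x ^ ((k : ℕ) + 1) := by
  have : ∑ j ∈ Finset.Iic k, (1 - x) * x ^ (j : ℕ) =
      ∑ j ∈ Finset.range (k + 1), (1 - x) * x ^ j := by
    rw [Nat.range_succ_eq_Iic, ← Fin.map_valEmbedding_Iic, Finset.sum_map]
    rfl
  rw [this, ← Finset.mul_sum, mul_comm, geom_sum_mul_neg]

theorem exists_list_pairwise_le {V κ : Type*} [Fintype V] [LinearOrder κ] (k : V → κ) :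
    ∃ vs : List V, (∀ v, v ∈ vs) ∧ vs.Nodup ∧ vs.Pairwise fun v v' => k v ≤ k v' := by
  let r : V → V → Prop := fun v v' => k v ≤ k v'
  have : Std.Total r := ⟨fun v v' => le_total (k v) (k v')⟩
  have : IsTrans V r := ⟨fun _ _ _ => le_trans⟩
  have hp := List.perm_insertionSort r (Finset.univ : Finset V).toList
  exact ⟨_, fun v => hp.mem_iff.2 (by simp), hp.nodup_iff.2 (Finset.nodup_toList _),
    List.pairwise_insertionSort r _⟩

/-! ### From adaptive to non-adaptive strategies -/

namespace StochasticGraph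

variable {U V : Type*} [DecidableEq U] [DecidableEq V]

theorem sum_map_ite_fst_le_one {l : List (U × V)} (hl : l.Pairwise fun e f => e.1 ≠ f.1) (u : U) :
    (l.map fun f => if f.1 = u then (1 : ℝ) else 0).sum ≤ 1 := by
  induction l with
  | nil => simp
  | cons e l ih =>
    rw [List.pairwise_cons] at hl
    rw [List.map_cons, List.sum_cons]
    split_ifs with h
    · have : (l.map fun f => if f.1 = u then (1 : ℝ) else 0).sum = 0 := by
        refine List.sum_eq_zero fun x hx => ?_
        obtain ⟨f, hf, rfl⟩ := List.mem_map.1 hx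
        exact if_neg fun hfu => hl.1 f hf (h.trans hfu.symm)
      rw [this, add_zero]
    · rw [zero_add]
      exact ih hl.2

variable [Fintype U] [Fintype V]

theorem Feasible.value_eq {G : StochasticGraph U V} {t : ProbeTree (U × V)} (ht : G.Feasible t) :
    G.value t = ∑ f, G.w f * t.matchProb G.p f :=
  ht.nodupProbes.sum_stateWeight_matched G.p G.w

theorem Feasible.sum_matchProb_le_one {G : StochasticGraph U V} {t : ProbeTree (U × V)}
    (ht : G.Feasible t) (u : U) : ∑ v, t.matchProb G.p (u, v) ≤ 1 := by
  have h := ht.nodupProbes.sum_stateWeight_matched G.p (fun f => if f.1 = u then 1 else 0)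
  have h2 : ∑ f : U × V, (if f.1 = u then (1 : ℝ) else 0) * t.matchProb G.p f =
      ∑ v, t.matchProb G.p (u, v) := by
    rw [Fintype.sum_prod_type]
    simp
  rw [← h2, ← h]
  refine le_of_le_of_eq ?_ (sum_stateWeight G.p)
  refine Finset.sum_le_sum fun st _ => ?_
  refine mul_le_of_le_one_right (stateWeight_nonneg G.p_nonneg G.p_le_one st) ?_
  exact sum_map_ite_fst_le_one ((ht st).2.imp fun h => h.1) u

/-- The expected weight, or a lower bound for it, when every `v` proposes to `u` at time `k` with
probability `z v u k`, independently of the others, and `u` accepts the first proposal. -/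
def proposalValue (w : U × V → ℝ) {N : ℕ} (z : V → U → Fin N → ℝ) : ℝ :=
  ∑ f : U × V, w f * ∑ k, ∏ v,
    if v = f.2 then z v f.1 k else 1 - ∑ j ∈ Finset.Iic k, z v f.1 j

/-- In each product the vector `z v` enters exactly one factor, affinely. -/
theorem isMultiAffine_proposalValue (w : U × V → ℝ) (N : ℕ) :
    IsMultiAffine (proposalValue w (N := N)) := by
  refine IsMultiAffine.sum fun f _ => IsMultiAffine.const_mul (IsMultiAffine.sum fun k _ => ?_) _
  refine isMultiAffine_prod (g := fun v (x : U → Fin N → ℝ) =>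
    if v = f.2 then x f.1 k else 1 - ∑ j ∈ Finset.Iic k, x f.1 j) fun v x y a b hab => ?_
  split_ifs
  · simp
  · simp only [Pi.add_apply, Pi.smul_apply, smul_eq_mul, Finset.sum_add_distrib, ← Finset.mul_sum]
    linear_combination -hab

theorem exists_nonAdaptive_ge_proposalValue (G : StochasticGraph U V) {N : ℕ}
    {z : V → U → Fin N → ℝ} (hz : ∀ v, z v ∈ G.timedVectors N v) :
    ∃ t, G.Feasible t ∧ t.NonAdaptive ∧ proposalValue G.w z ≤ G.value t := by
  choose k L A hC hA hz using hz
  have hL : ∀ v, ∀ x ∈ L v, x.1.2 = v := fun v x hx =>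
    G.incident_of_mem v _ (hC v) _ (List.mem_map_of_mem hx)
  obtain ⟨vs, hmem, hnodup, hsorted⟩ := exists_list_pairwise_le k
  have hfeas := G.feasible_blockTree hC A hnodup ∅
  refine ⟨blockTree L A vs ∅, hfeas, nonAdaptive_blockTree _ _ _ _, ?_⟩
  set q : V → U × V → ℝ := fun v => proposeProb G.p (A v) (L v) with hq
  have hq01 : ∀ v f, q v f ∈ Set.Icc (0 : ℝ) 1 := fun v f =>
    proposeProb_mem_Icc G.p_nonneg G.p_le_one _ _ f
  have hq0 : ∀ v f, f.2 ≠ v → q v f = 0 := fun v f hf => proposeProb_eq_zero_of_ne (hL v) hf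
  rw [hfeas.value_eq, proposalValue]
  refine Finset.sum_le_sum fun f _ => ?_
  rw [matchProb_blockTree G.p A hL, if_neg (Finset.notMem_empty _), one_mul]
  have hprod : (∑ j, ∏ v, if v = f.2 then z v f.1 j else 1 - ∑ i ∈ Finset.Iic j, z v f.1 i) =
      q f.2 f * (vs.map fun v => if v ≠ f.2 ∧ k v ≤ k f.2 then 1 - q v (f.1, v) else 1).prod := by
    -- Now that the times are fixed, `f.2` proposes only at time `k f.2`.
    rw [Finset.sum_eq_single (k f.2)]
    · have hvs : (vs.map fun v => if v ≠ f.2 ∧ k v ≤ k f.2 then 1 - q v (f.1, v) else 1).prod =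
          ∏ v, if v ≠ f.2 ∧ k v ≤ k f.2 then 1 - q v (f.1, v) else 1 := by
        rw [← List.prod_toFinset _ hnodup]
        congr 1
        ext v
        simp [hmem v]
      have hone : q f.2 f = ∏ v, if v = f.2 then q f.2 f else 1 := by simp
      rw [hvs, hone, ← Finset.prod_mul_distrib]
      refine Finset.prod_congr rfl fun v _ => ?_
      by_cases hv : v = f.2
      · simp [hv, hz f.2, hq]
      · by_cases hk : k v ≤ k f.2 <;> simp [hv, hk, hz v, hq]
    · intro j _ hj
      refine Finset.prod_eq_zero (Finset.mem_univ f.2) ?_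
      simp [hz f.2, hj]
    · simp
  rw [hprod]
  by_cases hw : 0 ≤ G.w f
  · exact mul_le_mul_of_nonneg_left (le_blockProb hq01 k hsorted (hmem _)) hw
  -- For a negative weight the bound on the matching probability would reverse, but such an edge is
  -- never accepted, so both sides vanish.
  · have hqf : q f.2 f = 0 := by
      rw [hq]
      dsimp only
      rw [proposeProb_eq_ite, if_neg fun h => hw (hA _ _ h), zero_mul]
    rw [blockProb_eq_zero hq0 vs hqf, hqf, zero_mul]

theorem Feasible.exists_nonAdaptive_ge {G : StochasticGraph U V} {t : ProbeTree (U × V)}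
    (ht : G.Feasible t) {N : ℕ} (hN : N ≠ 0) :
    ∃ t', G.Feasible t' ∧ t'.NonAdaptive ∧
      (1 - 1 / N : ℝ) * (1 - (1 - 1 / N : ℝ) ^ N) * G.value t ≤ G.value t' := by
  set α : ℝ := 1 / N with hα
  have hN' : (0 : ℝ) < N := Nat.cast_pos.2 (Nat.pos_of_ne_zero hN)
  have hα0 : 0 ≤ α := by positivity
  have hα1 : α ≤ 1 := by
    rw [hα, div_le_one hN']
    exact_mod_cast Nat.one_le_iff_ne_zero.2 hN
  set m : U × V → ℝ := t.matchProb G.p with hm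
  have hm0 : ∀ f, 0 ≤ m f := t.matchProb_nonneg G.p_nonneg G.p_le_one
  have hm1 : ∀ f, m f ≤ 1 := fun f =>
    (Finset.single_le_sum (f := fun v => m (f.1, v)) (fun v _ => hm0 _)
      (Finset.mem_univ f.2)).trans (ht.sum_matchProb_le_one f.1)
  set r : U × V → ℝ := fun f => 1 - α * m f with hr
  have hr0 : ∀ f, 0 ≤ r f := fun f => by
    have := mul_le_one₀ hα1 (hm0 f) (hm1 f)
    simp only [hr]; linarith
  have hr1 : ∀ f, r f ≤ 1 := fun f => by
    have := mul_nonneg hα0 (hm0 f)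
    simp only [hr]; linarith
  -- Discrete form of the attenuation `exp (-t * m)`. It makes the chance of no proposal up to a
  -- given time a pure power of `r`, whose product over `v` is controlled by `∑ v, m (u, v)`.
  let a : V → U → Fin N → ℝ := fun v u k => if G.w (u, v) < 0 then 0 else r (u, v) ^ (k : ℕ)
  have ha : ∀ v u k, a v u k ∈ Set.Icc (0 : ℝ) 1 := by
    intro v u k
    simp only [a]
    split_ifs
    · simp
    · exact ⟨pow_nonneg (hr0 _) _, pow_le_one₀ (hr0 _) (hr1 _)⟩
  let z : V → U → Fin N → ℝ := fun v u k => α * (a v u k * m (u, v))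
  have hz : ∀ v, z v ∈ convexHull ℝ (G.timedVectors N v) := by
    intro v
    refine G.smul_mem_convexHull_timedVectors hN v ?_ (ha v) fun u j hw => if_pos hw
    exact G.matchProb_mem_convexHull v t [] ht.nodupProbes (fun st => (ht st).1 v)
      fun st => (ht st).2.imp fun h => h.2
  obtain ⟨y, hy, hle⟩ := (isMultiAffine_proposalValue G.w N).exists_ge_of_mem_convexHull hz
  obtain ⟨t', h1, h2, h3⟩ := G.exists_nonAdaptive_ge_proposalValue hy
  refine ⟨t', h1, h2, le_trans ?_ (hle.trans h3)⟩
  rw [ht.value_eq, proposalValue, Finset.mul_sum]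
  refine Finset.sum_le_sum fun f _ => ?_
  have hc : 0 ≤ (1 - α) * (1 - (1 - α) ^ N) :=
    mul_nonneg (sub_nonneg.2 hα1)
      (sub_nonneg.2 (pow_le_one₀ (sub_nonneg.2 hα1) (by linarith)))
  by_cases hw : G.w f < 0
  · have : ∀ k : Fin N, (∏ v, if v = f.2 then z v f.1 k else
        1 - ∑ j ∈ Finset.Iic k, z v f.1 j) = 0 := by
      intro k
      refine Finset.prod_eq_zero (Finset.mem_univ f.2) ?_
      simp [z, a, hw]
    rw [Finset.sum_eq_zero fun k _ => this k, mul_zero]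
    exact mul_nonpos_of_nonneg_of_nonpos hc (mul_nonpos_of_nonpos_of_nonneg hw.le (hm0 f))
  · have hw' : 0 ≤ G.w f := not_lt.1 hw
    rw [mul_left_comm]
    refine mul_le_mul_of_nonneg_left ?_ hw'
    have hprodr : 1 - α ≤ ∏ v, r (f.1, v) := by
      refine le_trans ?_ (one_sub_sum_le_prod _ (fun v => mul_nonneg hα0 (hm0 (f.1, v)))
        fun v => mul_le_one₀ hα1 (hm0 _) (hm1 _))
      rw [← Finset.mul_sum]
      have := mul_le_mul_of_nonneg_left (ht.sum_matchProb_le_one f.1) hα0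
      linarith
    have hblock : ∀ v (k : Fin N), r (f.1, v) ^ ((k : ℕ) + 1) ≤
        1 - ∑ j ∈ Finset.Iic k, z v f.1 j := by
      intro v k
      by_cases hwv : G.w (f.1, v) < 0
      · simp only [z, a, hwv, if_true, zero_mul, mul_zero, Finset.sum_const_zero, sub_zero]
        exact pow_le_one₀ (hr0 _) (hr1 _)
      · have := sum_Iic_geom k (r (f.1, v))
        have h2 : ∑ j ∈ Finset.Iic k, z v f.1 j =
            ∑ j ∈ Finset.Iic k, (1 - r (f.1, v)) * r (f.1, v) ^ (j : ℕ) := by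
          refine Finset.sum_congr rfl fun j _ => ?_
          simp only [z, a, hwv, if_false, hr]
          ring
        rw [h2, this]
        linarith
    -- The product on the right skips `v = f.2`; since `r f ≤ 1`, an extra factor `r f` may be
    -- inserted there to get the product over all `v`.
    have hterm : ∀ k : Fin N, α * m f * (1 - α) ^ ((k : ℕ) + 1) ≤
        ∏ v, if v = f.2 then z v f.1 k else 1 - ∑ j ∈ Finset.Iic k, z v f.1 j := by
      intro k
      have hsplit : α * m f * ∏ v, r (f.1, v) ^ ((k : ℕ) + 1) =
          ∏ v, (if v = f.2 then α * m f else 1) * r (f.1, v) ^ ((k : ℕ) + 1) := by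
        rw [Finset.prod_mul_distrib]
        simp
      calc α * m f * (1 - α) ^ ((k : ℕ) + 1)
          ≤ α * m f * ∏ v, r (f.1, v) ^ ((k : ℕ) + 1) := by
            rw [Finset.prod_pow]
            exact mul_le_mul_of_nonneg_left (pow_le_pow_left₀ (sub_nonneg.2 hα1) hprodr _)
              (mul_nonneg hα0 (hm0 f))
        _ ≤ _ := by
            rw [hsplit]
            refine Finset.prod_le_prod (fun v _ => ?_) fun v _ => ?_
            · refine mul_nonneg ?_ (pow_nonneg (hr0 _) _)
              split_ifs
              · exact mul_nonneg hα0 (hm0 f)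
              · exact zero_le_one
            · by_cases hv : v = f.2
              · subst hv
                simp only [if_true, z, a, Prod.mk.eta, hw, if_false]
                rw [pow_succ]
                have h1 := pow_nonneg (hr0 f) k
                have h2 := mul_nonneg (mul_nonneg hα0 (hm0 f)) h1
                nlinarith [mul_nonneg h2 (sub_nonneg.2 (hr1 f))]
              · simp only [hv, if_false, one_mul]
                exact hblock v k
    refine le_trans (le_of_eq ?_) (Finset.sum_le_sum fun k _ => hterm k)
    have hgeom := geom_sum_mul_neg (1 - α) N
    rw [sub_sub_cancel] at hgeom
    rw [Fin.sum_univ_eq_sum_range (fun k => α * m f * (1 - α) ^ (k + 1)), ← hgeom,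
      Finset.sum_mul, Finset.mul_sum, Finset.sum_mul]
    refine Finset.sum_congr rfl fun k _ => ?_
    ring

/-! ### Suprema over randomized strategies -/

/-- A randomized strategy is at most as good as the best deterministic one. -/
theorem expectedWeight_le {G : StochasticGraph U V} {μ : PMF (ProbeTree (U × V))} {B : ℝ}
    (hB : 0 ≤ B) (h : ∀ t ∈ μ.support, G.value t ≤ B) : G.expectedWeight μ ≤ B := by
  by_cases hs : Summable fun t => (μ t).toReal * G.value t
  · have hsum : HasSum (fun t => (μ t).toReal) 1 := by
      have h1 : ∑' t, μ t ≠ ⊤ := by rw [μ.tsum_coe]; exact ENNReal.one_ne_top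
      have h2 := (ENNReal.summable_toReal h1).hasSum
      rwa [← ENNReal.tsum_toReal_eq fun t => μ.apply_ne_top t, μ.tsum_coe, ENNReal.toReal_one]
        at h2
    have hBsum := hsum.mul_right B
    rw [one_mul] at hBsum
    rw [expectedWeight, ← hBsum.tsum_eq]
    refine hs.tsum_le_tsum (fun t => ?_) hBsum.summable
    by_cases ht : t ∈ μ.support
    · exact mul_le_mul_of_nonneg_left (h t ht) ENNReal.toReal_nonneg
    · rw [PMF.mem_support_iff, not_not] at ht
      simp [ht]
  -- A divergent series has `tsum` equal to `0`; here the assumption `0 ≤ B` enters.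
  · rw [expectedWeight, tsum_eq_zero_of_not_summable hs]
    exact hB

theorem expectedWeight_pure (G : StochasticGraph U V) (t : ProbeTree (U × V)) :
    G.expectedWeight (PMF.pure t) = G.value t := by
  rw [expectedWeight, tsum_eq_single t]
  · simp
  · intro t' ht'
    simp [PMF.pure_apply, ht']

theorem Feasible.value_le {G : StochasticGraph U V} {t : ProbeTree (U × V)} (ht : G.Feasible t) :
    G.value t ≤ ∑ f, |G.w f| := by
  rw [ht.value_eq]
  refine Finset.sum_le_sum fun f _ => ?_
  have h0 : ∀ f, 0 ≤ t.matchProb G.p f := t.matchProb_nonneg G.p_nonneg G.p_le_one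
  have h1 : t.matchProb G.p f ≤ 1 :=
    (Finset.single_le_sum (f := fun v => t.matchProb G.p (f.1, v)) (fun v _ => h0 _)
      (Finset.mem_univ f.2)).trans (ht.sum_matchProb_le_one f.1)
  calc G.w f * t.matchProb G.p f ≤ |G.w f| * t.matchProb G.p f :=
        mul_le_mul_of_nonneg_right (le_abs_self _) (h0 f)
    _ ≤ |G.w f| := mul_le_of_le_one_right (abs_nonneg _) h1

theorem feasible_halt (G : StochasticGraph U V) : G.Feasible .halt := fun _ =>
  ⟨fun v => G.nil_mem v, List.Pairwise.nil⟩

theorem value_halt (G : StochasticGraph U V) : G.value .halt = 0 := by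
  simp [value, ProbeTree.matched]

theorem OPT_le {G : StochasticGraph U V} {B : ℝ} (hB : 0 ≤ B)
    (h : ∀ t, G.Feasible t → G.value t ≤ B) : G.OPT ≤ B := by
  refine Real.sSup_le ?_ hB
  rintro x ⟨μ, hμ, rfl⟩
  exact expectedWeight_le hB fun t ht => h t (hμ t ht)

theorem OPTNonAdaptive_le {G : StochasticGraph U V} {B : ℝ} (hB : 0 ≤ B)
    (h : ∀ t, G.Feasible t → t.NonAdaptive → G.value t ≤ B) : G.OPTNonAdaptive ≤ B := by
  refine Real.sSup_le ?_ hB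
  rintro x ⟨μ, hμ, rfl⟩
  exact expectedWeight_le hB fun t ht => h t (hμ t ht).1 (hμ t ht).2

theorem Feasible.value_le_OPT {G : StochasticGraph U V} {t : ProbeTree (U × V)}
    (ht : G.Feasible t) : G.value t ≤ G.OPT := by
  refine le_csSup ⟨∑ f, |G.w f|, ?_⟩ ⟨PMF.pure t, ?_, (G.expectedWeight_pure t).symm⟩
  · rintro x ⟨μ, hμ, rfl⟩
    exact expectedWeight_le (Finset.sum_nonneg fun _ _ => abs_nonneg _)
      fun t ht => (hμ t ht).value_le
  · intro t' ht'
    rw [PMF.support_pure, Set.mem_singleton_iff] at ht'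
    exact ht' ▸ ht

theorem Feasible.value_le_OPTNonAdaptive {G : StochasticGraph U V} {t : ProbeTree (U × V)}
    (ht : G.Feasible t) (hna : t.NonAdaptive) : G.value t ≤ G.OPTNonAdaptive := by
  refine le_csSup ⟨∑ f, |G.w f|, ?_⟩ ⟨PMF.pure t, ?_, (G.expectedWeight_pure t).symm⟩
  · rintro x ⟨μ, hμ, rfl⟩
    exact expectedWeight_le (Finset.sum_nonneg fun _ _ => abs_nonneg _)
      fun t ht => (hμ t ht).1.value_le
  · intro t' ht'
    rw [PMF.support_pure, Set.mem_singleton_iff] at ht'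
    exact ht' ▸ ⟨ht, hna⟩

theorem OPTNonAdaptive_nonneg (G : StochasticGraph U V) : 0 ≤ G.OPTNonAdaptive := by
  rw [← G.value_halt]
  exact G.feasible_halt.value_le_OPTNonAdaptive fun _ _ => rfl

theorem tendsto_discrete_ratio :
    Tendsto (fun N : ℕ => (1 - 1 / N : ℝ) * (1 - (1 - 1 / N : ℝ) ^ N)) atTop
      (𝓝 (1 - 1 / Real.exp 1)) := by
  have h1 : Tendsto (fun N : ℕ => (1 - 1 / N : ℝ)) atTop (𝓝 1) := by
    simpa using tendsto_one_div_atTop_nhds_zero_nat.const_sub (1 : ℝ)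
  have h2 : Tendsto (fun N : ℕ => (1 - 1 / N : ℝ) ^ N) atTop (𝓝 (1 / Real.exp 1)) := by
    have := Real.tendsto_one_add_div_pow_exp (-1)
    rw [Real.exp_neg, inv_eq_one_div] at this
    refine this.congr fun N => ?_
    ring
  simpa using h1.mul (h2.const_sub 1)

theorem le_OPTNonAdaptive (G : StochasticGraph U V) :
    (1 - 1 / Real.exp 1) * G.OPT ≤ G.OPTNonAdaptive := by
  have hpos := one_sub_one_div_exp_pos
  rw [← le_div_iff₀' hpos]
  refine OPT_le (div_nonneg G.OPTNonAdaptive_nonneg hpos.le) fun t ht => ?_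
  rw [le_div_iff₀' hpos]
  refine le_of_tendsto (tendsto_discrete_ratio.mul_const (G.value t)) ?_
  filter_upwards [eventually_ne_atTop 0] with N hN
  obtain ⟨t', h1, h2, h3⟩ := ht.exists_nonAdaptive_ge hN
  exact h3.trans (h1.value_le_OPTNonAdaptive h2)

end StochasticGraph

/-! ### The Erdős–Rényi graphs -/

namespace StochasticGraph

section NonAdaptive

variable {U V : Type*} [DecidableEq U] [DecidableEq V] [Fintype U] [Fintype V]

/-- A non-adaptive strategy matches `u` at most with the probability that one of the edges at `u`
which it probes is active. -/
theorem Feasible.sum_matchProb_le_of_probes {G : StochasticGraph U V} {t : ProbeTree (U × V)}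
    (ht : G.Feasible t) {P : List (U × V)} (hP : ∀ st, t.probes st = P) (u : U) :
    ∑ v, t.matchProb G.p (u, v) ≤
      1 - ∏ e : U × V, (if e ∈ P ∧ e.1 = u then 1 - G.p e else 1) := by
  have h := ht.nodupProbes.sum_stateWeight_matched G.p (fun f => if f.1 = u then 1 else 0)
  have h2 : ∑ f : U × V, (if f.1 = u then (1 : ℝ) else 0) * t.matchProb G.p f =
      ∑ v, t.matchProb G.p (u, v) := by
    rw [Fintype.sum_prod_type]
    simp
  -- For given states this product is the indicator that no probed edge at `u` is active; by
  -- independence its expectation factors.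
  have h3 := sum_stateWeight_mul_prod G.p
    (fun e b => if e ∈ P ∧ e.1 = u ∧ b = true then 0 else 1)
  have h4 : ∏ e : U × V, (if e ∈ P ∧ e.1 = u then 1 - G.p e else 1) =
      ∑ st, stateWeight G.p st *
        ∏ e, (if e ∈ P ∧ e.1 = u ∧ st e = true then (0 : ℝ) else 1) := by
    rw [h3]
    refine Finset.prod_congr rfl fun e _ => ?_
    by_cases he : e ∈ P ∧ e.1 = u
    · simp [he.1, he.2]
    · have : ¬ (e ∈ P ∧ e.1 = u ∧ true = true) := fun h => he ⟨h.1, h.2.1⟩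
      rw [if_neg he, if_neg this]
      simp
  rw [← h2, ← h, h4]
  refine le_of_le_of_eq ?_ (congrArg (· - _) (sum_stateWeight G.p))
  rw [← Finset.sum_sub_distrib]
  refine Finset.sum_le_sum fun st _ => ?_
  rw [← mul_one_sub]
  refine mul_le_mul_of_nonneg_left ?_ (stateWeight_nonneg G.p_nonneg G.p_le_one st)
  by_cases hex : ∃ e, e ∈ P ∧ e.1 = u ∧ st e = true
  · obtain ⟨e, he⟩ := hex
    have hzero : ∏ e, (if e ∈ P ∧ e.1 = u ∧ st e = true then (0 : ℝ) else 1) = 0 :=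
      Finset.prod_eq_zero (Finset.mem_univ e) (if_pos he)
    rw [hzero, sub_zero]
    exact sum_map_ite_fst_le_one ((ht st).2.imp fun h => h.1) u
  · push Not at hex
    have hone : ∏ e, (if e ∈ P ∧ e.1 = u ∧ st e = true then (0 : ℝ) else 1) ≤ 1 :=
      Finset.prod_le_one (fun e _ => by split_ifs <;> norm_num)
        fun e _ => by split_ifs <;> norm_num
    refine le_trans (le_of_eq ?_) (sub_nonneg.2 hone)
    refine List.sum_eq_zero fun x hx => ?_
    obtain ⟨f, hf, rfl⟩ := List.mem_map.1 hx
    refine if_neg fun hfu => hex f ?_ hfu (t.state_of_mem_matched st f hf)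
    rw [← hP st]
    exact (t.matched_sublist_probes st).subset hf

end NonAdaptive

section ErdosRenyi

variable {s n : ℕ} {p : unitInterval}

theorem value_erdosRenyiGraph {t : ProbeTree (Fin s × Fin n)}
    (ht : (erdosRenyiGraph s n p).Feasible t) :
    (erdosRenyiGraph s n p).value t = ∑ u, ∑ v, t.matchProb (fun _ => (p : ℝ)) (u, v) := by
  rw [ht.value_eq, Fintype.sum_prod_type]
  simp [erdosRenyiGraph]

theorem OPT_erdosRenyiGraph_le : (erdosRenyiGraph s n p).OPT ≤ s := by
  refine OPT_le (Nat.cast_nonneg s) fun t ht => ?_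
  rw [value_erdosRenyiGraph ht]
  exact (Finset.sum_le_sum fun u _ => ht.sum_matchProb_le_one u).trans_eq (by simp)

/-- The tangent `(2 - x) / e` to `exp (-x)` at `x = 1`, combined with `log (1 - p) ≥ -p / (1 - p)`.
Being linear in `m`, the bound can be summed over the offline vertices knowing only the total number
of probes. -/
theorem one_sub_pow_ge {p : ℝ} (hp : p < 1) (m : ℕ) :
    (2 - m * (p / (1 - p))) / Real.exp 1 ≤ (1 - p) ^ m := by
  have h0 : 0 < 1 - p := sub_pos.2 hp
  have h1 : -(p / (1 - p)) ≤ Real.log (1 - p) := by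
    refine le_trans (le_of_eq ?_) (Real.one_sub_inv_le_log_of_pos h0)
    field_simp
    ring
  have h2 := Real.add_one_le_exp (1 - m * (p / (1 - p)))
  rw [div_le_iff₀ (Real.exp_pos 1)]
  calc 2 - m * (p / (1 - p)) ≤ Real.exp (1 - m * (p / (1 - p))) := by linarith
    _ ≤ Real.exp (m * Real.log (1 - p) + 1) := by
      refine Real.exp_le_exp.2 ?_
      nlinarith [mul_le_mul_of_nonneg_left h1 (Nat.cast_nonneg (α := ℝ) m)]
    _ = (1 - p) ^ m * Real.exp 1 := by
      rw [Real.exp_add, Real.exp_nat_mul, Real.exp_log h0]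

theorem OPTNonAdaptive_erdosRenyiGraph_le (hp : (p : ℝ) < 1) :
    (erdosRenyiGraph s n p).OPTNonAdaptive ≤
      s - (2 * s - n * (p / (1 - p))) / Real.exp 1 := by
  have key : ∀ t, (erdosRenyiGraph s n p).Feasible t → t.NonAdaptive →
      (erdosRenyiGraph s n p).value t ≤ s - (2 * s - n * (p / (1 - p))) / Real.exp 1 := by
    intro t ht hna
    set P := t.probes fun _ => true with hPdef
    have hP : ∀ st, t.probes st = P := fun st => hna _ _
    let c : Fin s → ℕ := fun u => (P.toFinset.filter fun e => e.1 = u).card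
    -- Unit patience makes `Prod.snd` injective on the probed edges.
    have hc : ∑ u, c u ≤ n := by
      rw [← Finset.card_eq_sum_card_fiberwise fun _ _ => Finset.mem_univ _]
      refine (Finset.card_le_card_of_injOn Prod.snd (fun _ _ => Finset.mem_univ _)
        ?_).trans_eq (Finset.card_fin n)
      intro e he f hf hef
      have hlen := ((ht fun _ => true).1 e.2).2.2
      rw [← hPdef] at hlen
      have he' : e ∈ P.filter fun x => x.2 = e.2 := by
        simpa using he
      have hf' : f ∈ P.filter fun x => x.2 = e.2 := by
        simpa [hef] using hf
      match h : P.filter fun x => x.2 = e.2 with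
      | [] => simp [h] at he'
      | [x] =>
        rw [h, List.mem_singleton] at he' hf'
        rw [he', hf']
      | x :: y :: l => simp [h] at hlen
    have hu : ∀ u, ∑ v, t.matchProb (fun _ => (p : ℝ)) (u, v) ≤
        1 - (2 - c u * ((p : ℝ) / (1 - p))) / Real.exp 1 := by
      intro u
      refine (ht.sum_matchProb_le_of_probes hP u).trans (sub_le_sub_left ?_ _)
      refine (one_sub_pow_ge hp (c u)).trans (le_of_eq ?_)
      rw [Finset.prod_ite, Finset.prod_const_one, mul_one]
      simp only [erdosRenyiGraph, Finset.prod_const, c]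
      congr 2
      ext e
      simp
    rw [value_erdosRenyiGraph ht]
    refine (Finset.sum_le_sum fun u _ => hu u).trans ?_
    rw [Finset.sum_sub_distrib, ← Finset.sum_div, Finset.sum_sub_distrib, ← Finset.sum_mul,
      ← Nat.cast_sum]
    simp only [Finset.sum_const, Finset.card_univ, Fintype.card_fin, nsmul_eq_mul, mul_one]
    have hcr : ((∑ u, c u : ℕ) : ℝ) ≤ n := Nat.cast_le.2 hc
    have hr : 0 ≤ (p : ℝ) / (1 - p) := div_nonneg p.2.1 (sub_nonneg.2 p.2.2)
    have := mul_le_mul_of_nonneg_right hcr hr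
    gcongr ?_ - ?_ / _
    linarith
  refine OPTNonAdaptive_le ?_ key
  -- The bound is nonnegative because it already dominates the value `0` of the strategy that stops
  -- at once.
  rw [← value_halt (erdosRenyiGraph s n p)]
  exact key _ (feasible_halt _) fun _ _ => rfl

/-- Every online vertex probes its edge to the first unmatched offline vertex. -/
def greedyTree {U V : Type*} : List V → List U → ProbeTree (U × V)
  | [], _ => .halt
  | _ :: _, [] => .halt
  | v :: vs, u :: us => .probe (u, v) true (greedyTree vs (u :: us)) (greedyTree vs us)

theorem probes_greedyTree {U V : Type*} {vs : List V} (hvs : vs.Nodup) (us : List U)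
    (st : U × V → Bool) :
    (∀ e ∈ (greedyTree vs us).probes st, e.2 ∈ vs) ∧
      ((greedyTree vs us).probes st).Pairwise fun e f => e.2 ≠ f.2 := by
  induction vs generalizing us with
  | nil => simp [greedyTree, ProbeTree.probes]
  | cons v vs ih =>
    rw [List.nodup_cons] at hvs
    cases us with
    | nil => simp [greedyTree, ProbeTree.probes]
    | cons u us =>
      have key : ∀ l : List (U × V), ((∀ e ∈ l, e.2 ∈ vs) ∧ l.Pairwise fun e f => e.2 ≠ f.2) →
          (∀ e ∈ (u, v) :: l, e.2 ∈ v :: vs) ∧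
          ((u, v) :: l).Pairwise fun e f => e.2 ≠ f.2 := by
        refine fun l hl => ⟨?_, List.pairwise_cons.2 ⟨fun e he h => hvs.1 ?_, hl.2⟩⟩
        · rintro e he
          rcases List.mem_cons.1 he with rfl | he
          · exact List.mem_cons_self
          · exact List.mem_cons_of_mem _ (hl.1 e he)
        · rw [show v = e.2 from h]
          exact hl.1 e he
      rw [greedyTree, ProbeTree.probes]
      split_ifs
      · exact key _ (ih hvs.2 us)
      · exact key _ (ih hvs.2 (u :: us))

theorem matched_greedyTree {U V : Type*} (vs : List V) {us : List U} (hus : us.Nodup)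
    (st : U × V → Bool) :
    (∀ e ∈ (greedyTree vs us).matched st, e.1 ∈ us) ∧
      ((greedyTree vs us).matched st).Pairwise fun e f => e.1 ≠ f.1 := by
  induction vs generalizing us with
  | nil => simp [greedyTree, ProbeTree.matched]
  | cons v vs ih =>
    cases us with
    | nil => simp [greedyTree, ProbeTree.matched]
    | cons u us =>
      rw [greedyTree, ProbeTree.matched, if_pos rfl]
      split_ifs
      · rw [List.nodup_cons] at hus
        have h := ih hus.2
        refine ⟨?_, List.pairwise_cons.2 ⟨fun e he hue => hus.1 ?_, h.2⟩⟩
        · rintro e he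
          rcases List.mem_cons.1 he with rfl | he
          · exact List.mem_cons_self
          · exact List.mem_cons_of_mem _ (h.1 e he)
        · rw [show u = e.1 from hue]
          exact h.1 e he
      · exact ih hus

theorem feasible_greedyTree {vs : List (Fin n)} (hvs : vs.Nodup) {us : List (Fin s)}
    (hus : us.Nodup) : (erdosRenyiGraph s n p).Feasible (greedyTree vs us) := by
  intro st
  have hpr := probes_greedyTree hvs us st
  have hma := matched_greedyTree vs hus st
  have hpr2 := hpr.2.sublist ((greedyTree vs us).matched_sublist_probes st)
  refine ⟨fun v => ⟨?_, ?_, ?_⟩, hma.2.and hpr2⟩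
  · refine List.Nodup.filter _ (hpr.2.imp fun h hef => h (by rw [hef]))
  · intro e he
    simpa using (List.mem_filter.1 he).2
  · have h1 := hpr.2.filter fun e => decide (e.2 = v)
    match h : ((greedyTree vs us).probes st).filter fun e => decide (e.2 = v) with
    | [] => rw [h]; simp
    | [x] => rw [h]; simp
    | x :: y :: l =>
      rw [h] at h1
      have hx : ∀ z ∈ x :: y :: l, z.2 = v := by
        intro z hz
        rw [← h] at hz
        simpa using (List.mem_filter.1 hz).2
      refine absurd ?_ ((List.pairwise_cons.1 h1).1 y (by simp))
      rw [hx x (by simp), hx y (by simp)]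

/-- With `k = us.length` and `X` binomial, the loss is the expectation of `max 0 (k - X)`. It is
bounded through `x ≤ (x + a) ^ 2 / (4 * c)` for `x ≥ 0` and `0 < c ≤ a`, and the second moment of `k
- X + a` is its squared mean plus the variance. -/
theorem sum_matchProb_greedyTree_ge {U V : Type*} [Fintype U] [Fintype V] [DecidableEq U]
    [DecidableEq V] {p a c : ℝ} (hp : 0 ≤ p) (hp' : p ≤ 1) (hc : 0 < c) (hca : c ≤ a)
    (vs : List V) (us : List U) :
    us.length - ((us.length - vs.length * p + a) ^ 2 + vs.length * (p * (1 - p))) / (4 * c) ≤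
      ∑ f, (greedyTree vs us).matchProb (fun _ => p) f := by
  have hp1 := sub_nonneg.2 hp'
  induction vs generalizing us with
  | nil =>
    simp only [greedyTree, ProbeTree.matchProb, Finset.sum_const_zero, List.length_nil,
      Nat.cast_zero, zero_mul, sub_zero, add_zero, sub_nonpos]
    rw [le_div_iff₀ (by positivity)]
    have hk : (0 : ℝ) ≤ us.length := Nat.cast_nonneg _
    nlinarith [sq_nonneg ((us.length : ℝ) - c), mul_nonneg hk (sub_nonneg.2 hca),
      mul_nonneg hc.le (sub_nonneg.2 hca), sq_nonneg (a - c)]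
  | cons v vs ih =>
    cases us with
    | nil =>
      simp only [greedyTree, ProbeTree.matchProb, Finset.sum_const_zero, List.length_nil,
        Nat.cast_zero, sub_nonpos]
      positivity
    | cons u us =>
      have h1 := mul_le_mul_of_nonneg_left (ih us) hp
      have h0 := mul_le_mul_of_nonneg_left (ih (u :: us)) hp1
      have hsum : ∑ f, (greedyTree (v :: vs) (u :: us)).matchProb (fun _ => p) f =
          p * (1 + ∑ f, (greedyTree vs us).matchProb (fun _ => p) f) +
          (1 - p) * ∑ f, (greedyTree vs (u :: us)).matchProb (fun _ => p) f := by
        simp only [greedyTree, ProbeTree.matchProb, Finset.sum_add_distrib, ← Finset.mul_sum]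
        simp
      rw [hsum]
      -- An equality: one more Bernoulli trial adds exactly `p * (1 - p)` to the variance.
      refine le_trans (le_of_eq ?_) (add_le_add (add_le_add_right h1 p) h0 |>.trans_eq (by ring))
      simp only [List.length_cons, Nat.cast_add, Nat.cast_one]
      field_simp
      ring

theorem le_OPT_erdosRenyiGraph (hs : (s : ℝ) ≤ p * n) (hpn : 0 < (p : ℝ) * n) :
    s - √(p * n) / 2 ≤ (erdosRenyiGraph s n p).OPT := by
  set c := √((p : ℝ) * n) with hc
  have hc0 : 0 < c := Real.sqrt_pos.2 hpn
  have hc2 : c ^ 2 = p * n := Real.sq_sqrt hpn.le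
  have hf := feasible_greedyTree (p := p) (List.nodup_finRange n) (List.nodup_finRange s)
  refine le_trans ?_ hf.value_le_OPT
  rw [value_erdosRenyiGraph hf, ← Fintype.sum_prod_type']
  refine le_trans ?_ (sum_matchProb_greedyTree_ge p.2.1 p.2.2 hc0
    -- This `a` makes the mean of the shifted variable equal to `c = √(p * n)`. Mean square and
    -- variance are then each at most `c ^ 2`, and the loss is at most `2 * c ^ 2 / (4 * c) = c /
    -- 2`.
    (a := c + (p * n - s)) (by linarith) _ _)
  rw [List.length_finRange, List.length_finRange]
  refine sub_le_sub_left ?_ _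
  rw [div_le_div_iff₀ (by positivity) two_pos]
  have : (s - n * (p : ℝ) + (c + (p * n - s))) ^ 2 = c ^ 2 := by ring
  rw [this]
  nlinarith [mul_nonneg hpn.le p.2.1]

end ErdosRenyi

end StochasticGraph

/-! ### Asymptotics along the sequence -/

section Asymptotic

variable {s : ℕ → ℕ} {p : ℕ → unitInterval}

theorem isEquivalent_OPT_erdosRenyiGraph (hs : Tendsto s atTop atTop)
    (hle : ∀ n ≥ 1, (s n : ℝ) ≤ p n * n)
    (heq : (fun n => (s n : ℝ)) ~[atTop] (fun n => (p n : ℝ) * n)) :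
    (fun n => (erdosRenyiGraph (s n) n (p n)).OPT) ~[atTop] (fun n => (s n : ℝ)) := by
  have hspos : ∀ᶠ n in atTop, 0 < (s n : ℝ) :=
    (hs.eventually_gt_atTop 0).mono fun n hn => Nat.cast_pos.2 hn
  have hsR : Tendsto (fun n => (s n : ℝ)) atTop atTop := tendsto_natCast_atTop_atTop.comp hs
  rw [isEquivalent_iff_tendsto_one (hspos.mono fun n hn => hn.ne')]
  have hratio : Tendsto (fun n => (p n : ℝ) * n / s n) atTop (𝓝 1) :=
    (isEquivalent_iff_tendsto_one (hspos.mono fun n hn => hn.ne')).1 heq.symm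
  have hlow : Tendsto (fun n => 1 - √((p n : ℝ) * n / s n * (s n : ℝ)⁻¹) / 2) atTop (𝓝 1) := by
    have h1 := (hratio.mul (tendsto_inv_atTop_zero.comp hsR)).sqrt
    simpa using (h1.div_const 2).const_sub 1
  refine tendsto_of_tendsto_of_tendsto_of_le_of_le' hlow tendsto_const_nhds ?_ ?_
  · filter_upwards [hspos, eventually_ge_atTop 1] with n hn hn1
    have h := StochasticGraph.le_OPT_erdosRenyiGraph (hle n hn1) (hn.trans_le (hle n hn1))
    have hsq : √((p n : ℝ) * n / s n * (s n : ℝ)⁻¹) = √((p n : ℝ) * n) / s n := by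
      rw [← div_eq_mul_inv, div_div, ← sq, Real.sqrt_div' _ (sq_nonneg _), Real.sqrt_sq hn.le]
    rw [hsq, Pi.div_apply, le_div_iff₀ hn]
    refine le_trans (le_of_eq ?_) h
    field_simp
  · filter_upwards [hspos] with n hn
    rw [Pi.div_apply, div_le_one hn]
    exact StochasticGraph.OPT_erdosRenyiGraph_le

theorem exists_OPTNonAdaptive_erdosRenyiGraph_le
    (hp : (fun n => (p n : ℝ)) =o[atTop] (fun n : ℕ => 1 / √(n : ℝ)))
    (hs : Tendsto s atTop atTop)
    (heq : (fun n => (s n : ℝ)) ~[atTop] (fun n => (p n : ℝ) * n)) :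
    ∃ δ : ℕ → ℝ, Tendsto δ atTop (𝓝 0) ∧
      ∀ n, (erdosRenyiGraph (s n) n (p n)).OPTNonAdaptive
        ≤ (1 + δ n) * (1 - 1 / Real.exp 1) * s n := by
  have hc := one_sub_one_div_exp_pos
  have hspos : ∀ᶠ n in atTop, 0 < (s n : ℝ) :=
    (hs.eventually_gt_atTop 0).mono fun n hn => Nat.cast_pos.2 hn
  have hratio : Tendsto (fun n => (p n : ℝ) * n / s n) atTop (𝓝 1) :=
    (isEquivalent_iff_tendsto_one (hspos.mono fun n hn => hn.ne')).1 heq.symm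
  have hp0 : Tendsto (fun n => (p n : ℝ)) atTop (𝓝 0) := by
    refine hp.trans_tendsto ?_
    have : Tendsto (fun n : ℕ => √(n : ℝ)) atTop atTop :=
      Real.tendsto_sqrt_atTop.comp tendsto_natCast_atTop_atTop
    simpa [Function.comp_def] using tendsto_inv_atTop_zero.comp this
  let R : ℕ → ℝ := fun n => (erdosRenyiGraph (s n) n (p n)).OPTNonAdaptive /
    ((1 - 1 / Real.exp 1) * s n) - 1
  let B : ℕ → ℝ := fun n =>
    (1 - (2 - (p n : ℝ) * n / s n / (1 - p n)) / Real.exp 1) / (1 - 1 / Real.exp 1) - 1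
  have hB : Tendsto B atTop (𝓝 0) := by
    have h1 := hratio.div (hp0.const_sub 1) (by norm_num)
    have h2 := ((((h1.const_sub 2).div_const (Real.exp 1)).const_sub 1).div_const
      (1 - 1 / Real.exp 1)).sub_const 1
    have h3 : (1 - (2 - 1 / (1 - 0)) / Real.exp 1) / (1 - 1 / Real.exp 1) - 1 = 0 := by
      rw [sub_zero, div_one, show (2 - 1 : ℝ) = 1 by norm_num, div_self hc.ne', sub_self]
    rw [h3] at h2
    exact h2
  have hRB : ∀ᶠ n in atTop, R n ≤ B n := by
    filter_upwards [hspos, hp0.eventually_lt_const one_pos] with n hn hpn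
    refine sub_le_sub_right ?_ _
    rw [div_le_div_iff₀ (mul_pos hc hn) hc]
    have h := StochasticGraph.OPTNonAdaptive_erdosRenyiGraph_le (s := s n) (n := n) hpn
    refine (mul_le_mul_of_nonneg_right h hc.le).trans (le_of_eq ?_)
    have : (1 - (p n : ℝ)) ≠ 0 := (sub_pos.2 hpn).ne'
    field_simp
  -- The exact relative excess `R`, rather than `B`, is used because the inequality must hold for
  -- every `n`, while `B` dominates only eventually.
  refine ⟨fun n => max 0 (R n), ?_, fun n => ?_⟩
  · have hmax : Tendsto (fun n => max 0 (B n)) atTop (𝓝 0) := by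
      simpa using (tendsto_const_nhds (x := (0 : ℝ))).max hB
    exact tendsto_of_tendsto_of_tendsto_of_le_of_le' tendsto_const_nhds hmax
      (Eventually.of_forall fun n => le_max_left _ _)
      (hRB.mono fun n hn => max_le_max le_rfl hn)
  · rcases Nat.eq_zero_or_pos (s n) with h0 | h0
    · refine StochasticGraph.OPTNonAdaptive_le (by simp [h0]) fun t ht _ => ?_
      refine ht.value_le_OPT.trans (StochasticGraph.OPT_erdosRenyiGraph_le.trans ?_)
      simp [h0]
    · have hpos : 0 < (1 - 1 / Real.exp 1) * (s n : ℝ) := mul_pos hc (Nat.cast_pos.2 h0)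
      rw [mul_assoc, ← div_le_iff₀ hpos]
      have := le_max_right 0 (R n)
      simp only [R] at this ⊢
      linarith

end Asymptotic

/-! ### The adaptivity gap -/

theorem bddBelow_adaptivityRatios : BddBelow adaptivityRatios := by
  refine ⟨0, ?_⟩
  rintro r ⟨U, V, _, _, _, _, G, hG, rfl⟩
  exact div_nonneg G.OPTNonAdaptive_nonneg hG.le

theorem adaptivityGap_le : adaptivityGap ≤ 1 - 1 / Real.exp 1 := by
  -- With `s` about `n ^ (1/4)` and `p = s / n`, one has `p * n = s` for `n ≥ 1`, and `p * √n ≤ 1 /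
  -- s → 0` because `s ^ 2 ≤ √n`.
  let s : ℕ → ℕ := fun n => n.sqrt.sqrt
  have hsn : ∀ n, s n ≤ n := fun n => (Nat.sqrt_le_self _).trans (Nat.sqrt_le_self _)
  let p : ℕ → unitInterval := fun n => ⟨s n / n, by positivity,
    div_le_one_of_le₀ (Nat.cast_le.2 (hsn n)) (Nat.cast_nonneg n)⟩
  have hsqrt : Tendsto Nat.sqrt atTop atTop :=
    tendsto_atTop_atTop.2 fun b => ⟨b * b, fun n hn => Nat.le_sqrt.2 hn⟩
  have hs : Tendsto s atTop atTop := hsqrt.comp hsqrt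
  have hsR : Tendsto (fun n => (s n : ℝ)) atTop atTop := tendsto_natCast_atTop_atTop.comp hs
  have hspos : ∀ᶠ n in atTop, 0 < (s n : ℝ) :=
    (hs.eventually_gt_atTop 0).mono fun n hn => Nat.cast_pos.2 hn
  have hpn : ∀ n ≥ 1, (p n : ℝ) * n = s n := fun n hn =>
    div_mul_cancel₀ _ (Nat.cast_ne_zero.2 (Nat.one_le_iff_ne_zero.1 hn))
  have heq : (fun n => (s n : ℝ)) ~[atTop] (fun n => (p n : ℝ) * n) := by
    refine IsEquivalent.refl.congr_right ?_
    filter_upwards [eventually_ge_atTop 1] with n hn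
    exact (hpn n hn).symm
  have hp : (fun n => (p n : ℝ)) =o[atTop] (fun n : ℕ => 1 / √(n : ℝ)) := by
    have hne : ∀ᶠ n : ℕ in atTop, 0 < √(n : ℝ) := by
      filter_upwards [eventually_gt_atTop 0] with n hn
      exact Real.sqrt_pos.2 (Nat.cast_pos.2 hn)
    rw [isLittleO_iff_tendsto' (hne.mono fun n hn h => absurd h (by positivity))]
    refine tendsto_of_tendsto_of_tendsto_of_le_of_le' tendsto_const_nhds
      (tendsto_inv_atTop_zero.comp hsR) (Eventually.of_forall fun n => ?_) ?_
    · exact div_nonneg (p n).2.1 (by positivity)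
    · filter_upwards [hne, hspos, eventually_ge_atTop 1] with n hn hsn hn1
      have h1 : (s n : ℝ) * s n ≤ √(n : ℝ) := by
        refine le_trans ?_ Real.nat_sqrt_le_real_sqrt
        exact_mod_cast Nat.sqrt_le n.sqrt
      have h2 : (p n : ℝ) * (√n * √n) = s n := by
        rw [Real.mul_self_sqrt (Nat.cast_nonneg n), hpn n hn1]
      rw [Function.comp_apply, div_div_eq_mul_div, div_one, ← one_div, le_div_iff₀ hsn]
      refine le_of_mul_le_mul_right ?_ hn
      calc (p n : ℝ) * √n * s n * √n = p n * (√n * √n) * s n := by ring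
        _ = s n * s n := by rw [h2]
        _ ≤ 1 * √n := by rwa [one_mul]
  obtain ⟨δ, hδ, hle⟩ := exists_OPTNonAdaptive_erdosRenyiGraph_le hp hs heq
  have hOPT := isEquivalent_OPT_erdosRenyiGraph hs (fun n hn => (hpn n hn).ge) heq
  have hratio : Tendsto (fun n => (erdosRenyiGraph (s n) n (p n)).OPT / s n) atTop (𝓝 1) :=
    (isEquivalent_iff_tendsto_one (hspos.mono fun n hn => hn.ne')).1 hOPT
  have hlim : Tendsto (fun n => (1 + δ n) * (1 - 1 / Real.exp 1) /
      ((erdosRenyiGraph (s n) n (p n)).OPT / s n)) atTop (𝓝 (1 - 1 / Real.exp 1)) := by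
    have h := ((hδ.const_add 1).mul_const (1 - 1 / Real.exp 1)).div hratio one_ne_zero
    rw [add_zero, one_mul, div_one] at h
    exact h
  refine ge_of_tendsto hlim ?_
  filter_upwards [hspos, hratio.eventually_const_lt one_pos] with n hn hpos
  have hOPTpos : 0 < (erdosRenyiGraph (s n) n (p n)).OPT := (div_pos_iff_of_pos_right hn).1 hpos
  have hmem : (erdosRenyiGraph (s n) n (p n)).OPTNonAdaptive /
      (erdosRenyiGraph (s n) n (p n)).OPT ∈ adaptivityRatios :=
    ⟨Fin (s n), Fin n, inferInstance, inferInstance, inferInstance, inferInstance, _, hOPTpos, rfl⟩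
  refine (csInf_le bddBelow_adaptivityRatios hmem).trans ?_
  rw [div_div_eq_mul_div]
  exact div_le_div_of_nonneg_right (hle n) hOPTpos.le

theorem le_adaptivityGap (h : adaptivityRatios.Nonempty) :
    1 - 1 / Real.exp 1 ≤ adaptivityGap := by
  refine le_csInf h ?_
  rintro r ⟨U, V, _, _, _, _, G, hG, rfl⟩
  rw [le_div_iff₀ hG]
  exact G.le_OPTNonAdaptive

/-- Needed because the real `sInf` of the empty set is `0`. The witness is a single certain edge,
for which the greedy bound gives `OPT ≥ 1 / 2`. -/
theorem adaptivityRatios_nonempty : adaptivityRatios.Nonempty := by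
  have h := StochasticGraph.le_OPT_erdosRenyiGraph (s := 1) (n := 1) (p := 1) (by simp) (by simp)
  have hpos : 0 < (erdosRenyiGraph 1 1 1).OPT := lt_of_lt_of_le (by norm_num) h
  exact ⟨_, Fin 1, Fin 1, inferInstance, inferInstance, inferInstance, inferInstance, _, hpos, rfl⟩

theorem mainTheorem8 :
    adaptivityGap ≤ 1 - 1 / Real.exp 1 ∧
    (∀ (s : ℕ → ℕ) (p : ℕ → unitInterval),
      (fun n => (p n : ℝ)) =o[atTop] (fun n : ℕ => 1 / √(n : ℝ)) →
      Tendsto s atTop atTop →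
      (∀ n ≥ 1, (s n : ℝ) ≤ p n * n) →
      (fun n => (s n : ℝ)) ~[atTop] (fun n => (p n : ℝ) * n) →
      (fun n => (erdosRenyiGraph (s n) n (p n)).OPT) ~[atTop] (fun n => (s n : ℝ)) ∧
      ∃ δ : ℕ → ℝ, Tendsto δ atTop (𝓝 0) ∧
        ∀ n, (erdosRenyiGraph (s n) n (p n)).OPTNonAdaptive
          ≤ (1 + δ n) * (1 - 1 / Real.exp 1) * s n) ∧
    adaptivityGap = 1 - 1 / Real.exp 1 :=
  ⟨adaptivityGap_le,
    fun _ _ hp hs hle heq => ⟨isEquivalent_OPT_erdosRenyiGraph hs hle heq,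
      exists_OPTNonAdaptive_erdosRenyiGraph_le hp hs heq⟩,
    le_antisymm adaptivityGap_le (le_adaptivityGap adaptivityRatios_nonempty)⟩
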